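/- **Setting.** A POMDP is a tuple $G=(S,A,\delta,O,\gamma,s_0)$ with finite sets $S$ of states, $A$ of actions and $O$ of observations, a probabilistic transition function $\delta:S\times A\to\mathcal D(S)$, an observation function $\gamma:S\to O$, and an initial state $s_0$ that is the only state with its observation. A reward function is a map $r:S\times A\to[0,1]$. A strategy with memory set $M$ consists of an action selection $\sigma_n:M\to\mathcal D(A)$, a memory update $\sigma_u:M\times O\times A\to\mathcal D(M)$ and an initial memory $m_0\in M$: in state $s$ with memory $m$ an action $a$ is drawn from $\sigma_n(m)$, the next state $s'$ from $\delta(s,a)$, and the next memory from $\sigma_u(m,\gamma(s'),a)$. It is a finite-memory strategy if $M$ is finite, and $|M|$ is its memory size. It is almost-sure winning (for the objective $\mathrm{LimAvg}=1$) if the induced probability measure on plays $(s_0,a_0,s_1,a_1,\dots)$ gives probability $1$ to the set of plays with $\liminf_{n\to\infty}\frac1n\sum_{i=0}^{n} r(s_i,a_i)=1$. The belief update of $Y\subseteq S$ under $a\in A$, $o\in O$ is $\bigl(\bigcup_{s\in Y}\mathrm{supp}\,\delta(s,a)\bigr)\cap\gamma^{-1}(o)$. A belief-based strategy has as its memory exactly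 the belief (a subset of $S$, initially $\{s_0\}$, changed by the belief update) and plays an arbitrary distribution over actions that depends only on the belief. Given a finite-memory strategy $\sigma$, for $m\in M$ let $W(m)$ be the set of states $s$ such that $\sigma$ started from $(s,m)$ is almost-sure winning, $R(m)$ the set of $s$ such that $(s,m)$ lies in a recurrent class (bottom strongly connected component) of the Markov chain that $\sigma$ induces on $S\times M$, and $L(m)=(W(m),R(m),\mathrm{supp}\,\sigma_n(m))$. The collapsed strategy $\sigma'$ of $\sigma$ has memory set $\{(Y,L(m)) : Y\subseteq S,\ m\in M\}$ and initial memory $(\{s_0\},L(m_0))$. Put an edge $(Y,L)\xrightarrow{a}(Y',L')$ if there are $m,m'\in M$ and $o\in O$ with $L=L(m)$, $L'=L(m')$, $a\in\mathrm{supp}\,\sigma_n(m)$, $m'\in\mathrm{supp}\,\sigma_u(m,o,a)$, and $Y'\ne\emptyset$ is the belief update of $Y$ under $a,o$. In $(Y,L)$ the strategy $\sigma'$ plays uniformly the actions that label outgoing edges, and after action $a$ and observation $o$ it updates its memory uniformly over the $a$-successors $(Y',L')$ with $Y'\subseteq\gamma^{-1}(o)$ (with an arbitrary convention where these sets are empty,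 which never matters from the initial configuration). **Theorem (Strategy complexity).** 1. If a POMDP $G$ with reward function $r$ has a finite-memory almost-sure winning strategy, then it has one with memory size at most $2^{3|S|+|A|}$. More precisely, for every finite-memory almost-sure winning strategy $\sigma$, the collapsed strategy $\sigma'$ is almost-sure winning and has memory size at most $2^{3|S|+|A|}$. 2. (a) Exponential memory is necessary in general: there is a constant $C$ such that for every $n\ge1$ there are a POMDP with $|S|+|A|+|O|\le Cn$ and a reward function for which a finite-memory almost-sure winning strategy exists, but every finite-memory almost-sure winning strategy has memory size at least $2^n$. (b) Belief-based strategies are not sufficient. Let $S=\{s_0,X,X',Y,Y',Z,Z'\}$ and $A=\{a,b\}$. From $s_0$, either action leads to each of the other six states with probability $\frac16$; $X\xrightarrow{a}X'$, $X\xrightarrow{b}Y$, $X'\xrightarrow{a}Y'$, $X'\xrightarrow{b}X$, $Z\xrightarrow{a}Y$, $Z\xrightarrow{b}Z'$, $Z'\xrightarrow{a}Z$, $Z'\xrightarrow{b}Y'$ with probability $1$; from $Y$ either action leads to $X$ and $Z$ with probability $\frac12$ each, and from $Y'$ to $X'$ and $Z'$ with probability $\frac12$ each. The six states other than $s_0$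 have the same observation, which differs from that of $s_0$. The reward is $0$ in $Y$ and $Y'$ and $1$ in all other states. This POMDP has a finite-memory almost-sure winning strategy, but no belief-based strategy is almost-sure winning. -/

import Mathlib

open MeasureTheory ProbabilityTheory Filter

/-- A partially observable Markov decision process with states `S`, actions `A` and observations
`O`. All three are finite wherever the theorem speaks about POMDPs. The initial state is the only
state with its observation. -/
structure POMDP (S A O : Type*) where
  /-- the probabilistic transition function -/
  trans : S → A → PMF S
  /-- the observation function -/
  obs : S → O
  /-- the initial state -/
  init : S
  init_unique : ∀ s, obs s = obs init → s = init

/-- A (randomized, observation-based) strategy with memory set `M`. -/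
structure Strategy (M A O : Type*) where
  /-- action selection -/
  act : M → PMF A
  /-- memory update: old memory, new observation, action just played -/
  update : M → O → A → PMF M
  /-- initial memory -/
  init : M

/-- A play, as an infinite sequence of state-action pairs `(s₀, a₀), (s₁, a₁), …`. -/
def Play (S A : Type*) : Type _ := ℕ → S × A

/-- The σ-algebra generated by the cones (the product of the discrete ones). -/
instance Play.measurableSpace (S A : Type*) : MeasurableSpace (Play S A) :=
  @MeasurableSpace.pi ℕ (fun _ => S × A) (fun _ => ⊤)

/-- The limit-average payoff of a play. -/
noncomputable def limAvg {S A : Type*} (r : S → A → unitInterval) (ρ : Play S A) : ℝ :=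
  liminf (fun n : ℕ => (1 / (n : ℝ)) * ∑ i ∈ Finset.range (n + 1), (r (ρ i).1 (ρ i).2 : ℝ)) atTop

/-- The objective `LimAvg = 1`. -/
def limAvgOne {S A : Type*} (r : S → A → unitInterval) : Set (Play S A) :=
  {ρ | limAvg r ρ = 1}

/-- One instant of a run: current state, current memory, and the action played now. -/
def Config (S M A : Type*) : Type _ := S × M × A

instance Config.measurableSpace (S M A : Type*) : MeasurableSpace (Config S M A) := ⊤

namespace POMDP

variable {S A O : Type*}

/-- The belief after playing `a` from belief `Y` and observing `o`. -/
def beliefUpdate (G : POMDP S A O) (Y : Set S) (a : A) (o : O) : Set S :=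
  (⋃ s ∈ Y, (G.trans s a).support) ∩ G.obs ⁻¹' {o}

end POMDP

namespace Strategy

variable {S M A O : Type*}

/-- Law of the first instant of a run from state `s` and memory `m`. -/
noncomputable def startLaw (σ : Strategy M A O) (s : S) (m : M) : PMF (Config S M A) :=
  (σ.act m).map fun a => (s, m, a)

/-- Law of the next instant: sample the next state, then the next memory from the observation of
the next state, then the next action. -/
noncomputable def stepLaw (G : POMDP S A O) (σ : Strategy M A O) (c : Config S M A) :
    PMF (Config S M A) :=
  (G.trans c.1 c.2.2).bind fun s' =>
    (σ.update c.2.1 (G.obs s') c.2.2).bind fun m' => σ.startLaw s' m'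

/-- `stepLaw` as a kernel from histories of length `n + 1` to the next instant. -/
noncomputable def stepKernel (G : POMDP S A O) (σ : Strategy M A O) (n : ℕ) :
    Kernel (Finset.Iic n → Config S M A) (Config S M A) where
  toFun h := (σ.stepLaw G (h ⟨n, Finset.mem_Iic.2 le_rfl⟩)).toMeasure
  measurable' :=
    (measurable_from_top (f := fun c : Config S M A => (σ.stepLaw G c).toMeasure)).comp
      (measurable_pi_apply _)

instance (G : POMDP S A O) (σ : Strategy M A O) (n : ℕ) : IsMarkovKernel (σ.stepKernel G n) :=
  ⟨fun h => inferInstanceAs (IsProbabilityMeasure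
    (σ.stepLaw G (h ⟨n, Finset.mem_Iic.2 le_rfl⟩)).toMeasure)⟩

/-- Law of the whole run from state `s` and memory `m`. -/
noncomputable def runMeasure (G : POMDP S A O) (σ : Strategy M A O) (s : S) (m : M) :
    Measure (ℕ → Config S M A) :=
  Kernel.trajMeasure (X := fun _ => Config S M A) (σ.startLaw s m).toMeasure (σ.stepKernel G)

/-- The play underlying a run. -/
def playOf (ω : ℕ → Config S M A) : Play S A := fun n => ((ω n).1, (ω n).2.2)

theorem measurable_playOf : Measurable (playOf : (ℕ → Config S M A) → Play S A) := by
  let _ : MeasurableSpace (S × A) := ⊤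
  exact measurable_pi_lambda _ fun n =>
    (measurable_from_top (f := fun c : Config S M A => (c.1, c.2.2))).comp (measurable_pi_apply n)

/-- The probability measure on plays induced by the strategy from state `s` and memory `m`. -/
noncomputable def playMeasure (G : POMDP S A O) (σ : Strategy M A O) (s : S) (m : M) :
    Measure (Play S A) :=
  (σ.runMeasure G s m).map playOf

/-- `σ` is almost-sure winning in `G` for the objective `LimAvg = 1` of the reward `r`. -/
def AlmostSureWinning (G : POMDP S A O) (r : S → A → unitInterval) (σ : Strategy M A O) : Prop :=
  σ.playMeasure G G.init σ.init (limAvgOne r) = 1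

/-! ### The induced Markov chain on `S × M` -/

/-- Transition function of the Markov chain induced by `σ` on `S × M`. -/
noncomputable def chain (G : POMDP S A O) (σ : Strategy M A O) (x : S × M) : PMF (S × M) :=
  (σ.act x.2).bind fun a => (G.trans x.1 a).bind fun s' =>
    (σ.update x.2 (G.obs s') a).map fun m' => (s', m')

/-- Edges of the graph of the induced chain. -/
def Edge (G : POMDP S A O) (σ : Strategy M A O) (x y : S × M) : Prop :=
  y ∈ (σ.chain G x).support

/-- Recurrent classes: bottom strongly connected components. -/
def IsRecurrentClass (G : POMDP S A O) (σ : Strategy M A O) (C : Set (S × M)) : Prop :=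
  C.Nonempty ∧ (∀ x ∈ C, ∀ y ∈ C, Relation.ReflTransGen (σ.Edge G) x y) ∧
    ∀ x ∈ C, ∀ y, σ.Edge G x y → y ∈ C

/-- States `s` such that `(s, m)` is almost-sure winning in the induced chain. -/
def win (G : POMDP S A O) (r : S → A → unitInterval) (σ : Strategy M A O) (m : M) : Set S :=
  {s | σ.playMeasure G s m (limAvgOne r) = 1}

/-- States `s` such that `(s, m)` is recurrent in the induced chain. -/
def recur (G : POMDP S A O) (σ : Strategy M A O) (m : M) : Set S :=
  {s | ∃ C, σ.IsRecurrentClass G C ∧ (s, m) ∈ C}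

/-! ### The collapsed strategy -/

/-- The win, recurrence and action-support data of a memory element. -/
def label (G : POMDP S A O) (r : S → A → unitInterval) (σ : Strategy M A O) (m : M) :
    Set S × Set S × Set A :=
  (σ.win G r m, σ.recur G m, (σ.act m).support)

/-- Vertices of the collapsed graph: a set of states together with the label of some memory. -/
def CollapsedMemory (G : POMDP S A O) (r : S → A → unitInterval) (σ : Strategy M A O) : Type _ :=
  {v : Set S × Set S × Set S × Set A // ∃ m, v.2 = σ.label G r m}

/-- Edges of the collapsed graph, labeled by actions. -/
def CollapsedEdge (G : POMDP S A O) (r : S → A → unitInterval) (σ : Strategy M A O)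
    (v : σ.CollapsedMemory G r) (a : A) (w : σ.CollapsedMemory G r) : Prop :=
  ∃ (m m' : M) (o : O), v.1.2 = σ.label G r m ∧ w.1.2 = σ.label G r m' ∧
    a ∈ (σ.act m).support ∧ w.1.1.Nonempty ∧ w.1.1 = G.beliefUpdate v.1.1 a o ∧
    m' ∈ (σ.update m o a).support

/-- The uniform distribution on `s`; the point mass at `d` if `s` is empty. -/
noncomputable def uniformOr {α : Type*} [Finite α] (s : Set α) (d : α) : PMF α :=
  open Classical in
  if h : s.toFinite.toFinset.Nonempty then PMF.uniformOfFinset s.toFinite.toFinset h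
  else PMF.pure d

instance (G : POMDP S A O) (r : S → A → unitInterval) (σ : Strategy M A O) [Finite S] [Finite A] :
    Finite (σ.CollapsedMemory G r) :=
  inferInstanceAs (Finite {v : Set S × Set S × Set S × Set A // ∃ m, v.2 = σ.label G r m})

/-- The collapsed strategy: it plays uniformly the actions that label outgoing edges of the
collapsed graph and updates its memory uniformly along the edges that agree with the observation.
The fallback values of `uniformOr` only concern memory elements with an empty set of states,
actions that are not played, and observations that cannot occur. -/
noncomputable def collapse (G : POMDP S A O) (r : S → A → unitInterval) (σ : Strategy M A O)
    [Finite S] [Finite A] : Strategy (σ.CollapsedMemory G r) A O where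
  act v := uniformOr {a | ∃ w, σ.CollapsedEdge G r v a w} (σ.act σ.init).support_nonempty.some
  update v o a := uniformOr {w | σ.CollapsedEdge G r v a w ∧ w.1.1 ⊆ G.obs ⁻¹' {o}} v
  init := ⟨({G.init}, σ.label G r σ.init), σ.init, rfl⟩

/-! ### Belief-based strategies -/

/-- The belief-based strategy that plays the distribution `f Y` when the current belief is `Y`:
its memory is exactly the belief. -/
noncomputable def beliefBased (G : POMDP S A O) (f : Set S → PMF A) : Strategy (Set S) A O where
  act := f
  update Y o a := PMF.pure (G.beliefUpdate Y a o)
  init := {G.init}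

end Strategy

/-! ### The POMDP showing that beliefs are not sufficient -/

namespace BeliefExample

/-- The seven states. -/
inductive St
  | s0 | X | X' | Y | Y' | Z | Z'
  deriving DecidableEq

/-- The two actions. -/
inductive Ac
  | a | b

open St Ac

/-- Transitions: from `s0` uniformly to the six other states; from `Y` and `Y'` uniformly to two
states; deterministic otherwise. -/
noncomputable def trans : St → Ac → PMF St
  | s0, _ => PMF.uniformOfFinset {X, X', Y, Y', Z, Z'} ⟨X, by decide⟩
  | X, a => PMF.pure X'
  | X, b => PMF.pure Y
  | X', a => PMF.pure Y'
  | X', b => PMF.pure X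
  | Z, a => PMF.pure Y
  | Z, b => PMF.pure Z'
  | Z', a => PMF.pure Z
  | Z', b => PMF.pure Y'
  | Y, _ => PMF.uniformOfFinset {X, Z} ⟨X, by decide⟩
  | Y', _ => PMF.uniformOfFinset {X', Z'} ⟨X', by decide⟩

/-- The POMDP. The observation only tells whether the current state is `s0`. -/
noncomputable def pomdp : POMDP St Ac Bool where
  trans := trans
  obs s := decide (s = s0)
  init := s0
  init_unique s h := by simpa using h

/-- Reward `0` in `Y` and `Y'`, reward `1` elsewhere. -/
def reward : St → Ac → unitInterval
  | Y, _ => 0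
  | Y', _ => 0
  | _, _ => 1

end BeliefExample

/-! For a finite-memory strategy, almost-sure winning depends only on the graph of the chain on `S ×
M`: it holds iff every action played in a reachable recurrent configuration has reward `1`. If so,
the run almost surely enters the closed set of reachable recurrent configurations, and the rewards
are eventually all `1`. Conversely, bounded convergence makes the averaged expected loss of a
winning strategy tend to `0`, whereas a positive loss at a reachable recurrent configuration bounds
these averages away from `0`. The criterion is `playMeasure_limAvgOne_eq_one_iff`; its sufficient
half, for an arbitrary closed set, is `playMeasure_limAvgOne_eq_one_of_closed`.

Upper bound. Forgetting the memory but not its label keeps every step of `σ` possible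
(`collapse_simulates`), and each step of the collapsed strategy is a step of `σ` between memories
with the right labels (`exists_chain_of_collapse`). Since winning and recurrence pass to successors,
the belief stays inside the winning set of the label, and the configurations whose state is in
addition recurrent according to the label form a closed set with reward `1`. It stays reachable,
because a path of `σ` into a recurrent class can be imitated. A memory element consists of three
sets of states and one of actions, hence the bound.

Lower bound. Bits are shown, and any of them may secretly be the one that has to be repeated `n`
steps later; a mistake leads to a sink of reward `0`. If two words of length `n` could lead to the
same memory, showing the same further bits until a position where they differ falls due would keep
the memories equal, and any action then played would be wrong for one of the words.

Beliefs. The belief is constant after the first step, so a belief-based strategy can with positive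
probability repeat one action until `Y` or `Y'` is hit, from any state. Alternating the two actions
wins. -/

open scoped Topology

/-! ### Expectations over finite probability mass functions -/

namespace PMF

/-- The expected value of `f` under `p`. -/
noncomputable def mean {X : Type*} [Fintype X] (p : PMF X) (f : X → ℝ) : ℝ :=
  ∑ x, (p x).toReal * f x

variable {X Y : Type*}

theorem toReal_apply_pos {p : PMF X} {x : X} (h : x ∈ p.support) : 0 < (p x).toReal :=
  ENNReal.toReal_pos h (p.apply_ne_top x)

theorem toReal_apply_eq_zero {p : PMF X} {x : X} (h : x ∉ p.support) : (p x).toReal = 0 := by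
  rw [(p.apply_eq_zero_iff x).2 h, ENNReal.toReal_zero]

variable [Fintype X] [Fintype Y]

theorem sum_toReal (p : PMF X) : ∑ x, (p x).toReal = 1 := by
  rw [← ENNReal.toReal_sum fun x _ => p.apply_ne_top x, ← tsum_fintype (L := .unconditional X),
    p.tsum_coe, ENNReal.toReal_one]

theorem mean_const (p : PMF X) (c : ℝ) : p.mean (fun _ => c) = c := by
  rw [mean, ← Finset.sum_mul, p.sum_toReal, one_mul]

theorem mean_mono (p : PMF X) {f g : X → ℝ} (h : f ≤ g) : p.mean f ≤ p.mean g :=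
  Finset.sum_le_sum fun x _ => mul_le_mul_of_nonneg_left (h x) ENNReal.toReal_nonneg

theorem mean_pure (x : X) (f : X → ℝ) : (pure x).mean f = f x := by
  classical
  rw [mean, Finset.sum_eq_single x] <;> simp +contextual [pure_apply]

theorem mean_bind (p : PMF X) (k : X → PMF Y) (f : Y → ℝ) :
    (p.bind k).mean f = p.mean fun x => (k x).mean f := by
  simp only [mean, bind_apply, tsum_fintype]
  simp_rw [ENNReal.toReal_sum fun x _ => ENNReal.mul_ne_top (p.apply_ne_top x) ((k x).apply_ne_top _),
    ENNReal.toReal_mul, Finset.sum_mul, Finset.mul_sum]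
  rw [Finset.sum_comm]
  simp_rw [mul_assoc]

theorem mean_map (p : PMF X) (k : X → Y) (f : Y → ℝ) :
    (p.map k).mean f = p.mean fun x => f (k x) := by
  rw [← bind_pure_comp, mean_bind]
  simp [mean_pure]

theorem mul_le_mean (p : PMF X) {f : X → ℝ} (hf : 0 ≤ f) (x : X) : (p x).toReal * f x ≤ p.mean f :=
  Finset.single_le_sum (f := fun x => (p x).toReal * f x)
    (fun y _ => mul_nonneg ENNReal.toReal_nonneg (hf y)) (Finset.mem_univ x)

theorem mean_congr {p : PMF X} {f g : X → ℝ} (h : ∀ x ∈ p.support, f x = g x) :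
    p.mean f = p.mean g := by
  refine Finset.sum_congr rfl fun x _ => ?_
  by_cases hx : x ∈ p.support
  · rw [h x hx]
  · simp [toReal_apply_eq_zero hx]

/-- Maximum principle: the deficits `b - f y` are nonnegative on the support and have mean at most
`0`, so each of them vanishes there. -/
theorem eq_of_le_mean {p : PMF X} {f : X → ℝ} {b : ℝ} (hb : ∀ x ∈ p.support, f x ≤ b)
    (h : b ≤ p.mean f) {x : X} (hx : x ∈ p.support) : f x = b := by
  have h0 : ∑ y, (p y).toReal * (b - f y) = b - p.mean f := by
    simp_rw [mul_sub, Finset.sum_sub_distrib, ← Finset.sum_mul, p.sum_toReal, one_mul, mean]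
  have hn : ∀ y ∈ Finset.univ, 0 ≤ (p y).toReal * (b - f y) := fun y _ => by
    by_cases hy : y ∈ p.support
    · exact mul_nonneg ENNReal.toReal_nonneg (sub_nonneg.2 (hb y hy))
    · simp [toReal_apply_eq_zero hy]
  have := (Finset.sum_eq_zero_iff_of_nonneg hn).1
    (le_antisymm (by linarith) (Finset.sum_nonneg hn)) x (Finset.mem_univ x)
  have := (mul_eq_zero.1 this).resolve_left (toReal_apply_pos hx).ne'
  linarith

end PMF

/-! ### Finite Markov chains -/

namespace FiniteChain

variable {X : Type*}

/-- Reachability in the graph of the chain `K`. -/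
abbrev Reach (K : X → PMF X) : X → X → Prop := Relation.ReflTransGen fun x y => y ∈ (K x).support

/-- `x` lies in a bottom strongly connected component. -/
def Recurrent (K : X → PMF X) (x : X) : Prop := ∀ y, Reach K x y → Reach K y x

theorem Recurrent.of_reach {K : X → PMF X} {x y : X} (hx : Recurrent K x) (h : Reach K x y) :
    Recurrent K y := fun z hz => (hx z (h.trans hz)).trans h

/-- A reachable state whose own reachable set has minimal size is recurrent: moving on cannot shrink
that set. -/
theorem exists_reach_recurrent [Finite X] (K : X → PMF X) (x : X) :
    ∃ y, Reach K x y ∧ Recurrent K y := by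
  obtain ⟨y, hy, hmin⟩ := Set.exists_min_image {y | Reach K x y}
    (fun y => {z | Reach K y z}.ncard) (Set.toFinite _) ⟨x, .refl⟩
  refine ⟨y, hy, fun z hz => ?_⟩
  have hsub : {w | Reach K z w} ⊆ {w | Reach K y w} := fun w hw => hz.trans hw
  have := Set.eq_of_subset_of_ncard_le hsub (hmin z (hy.trans hz)) (Set.toFinite _)
  exact this.symm.subset (show Reach K y y from .refl)

variable [Fintype X]

/-- The Markov operator of the chain `K`. -/
noncomputable def markovOp (K : X → PMF X) : (X → ℝ) →ₗ[ℝ] (X → ℝ) where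
  toFun f x := (K x).mean f
  map_add' f g := by ext x; simp [PMF.mean, mul_add, Finset.sum_add_distrib]
  map_smul' c f := by ext x; simp [PMF.mean, Finset.mul_sum, mul_left_comm]

theorem markovOp_apply (K : X → PMF X) (f : X → ℝ) (x : X) : markovOp K f x = (K x).mean f := rfl

theorem markovOp_pow_mono (K : X → PMF X) (n : ℕ) : Monotone (markovOp K ^ n) := by
  induction n with
  | zero => exact fun f g h => h
  | succ n ih =>
    intro f g h
    rw [pow_succ, Module.End.mul_apply, Module.End.mul_apply]
    exact ih fun x => (K x).mean_mono h

theorem markovOp_pow_nonneg (K : X → PMF X) (n : ℕ) {f : X → ℝ} (hf : 0 ≤ f) :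
    0 ≤ (markovOp K ^ n) f := by
  simpa using markovOp_pow_mono K n hf

theorem exists_markovOp_pow_pos {K : X → PMF X} {x y : X} (h : Reach K x y) {f : X → ℝ}
    (hf : 0 ≤ f) (hy : 0 < f y) : ∃ n, 0 < (markovOp K ^ n) f x := by
  induction h using Relation.ReflTransGen.head_induction_on with
  | refl => exact ⟨0, hy⟩
  | @head a c hac _ ih =>
    obtain ⟨n, hn⟩ := ih
    refine ⟨n + 1, ?_⟩
    rw [pow_succ', Module.End.mul_apply, markovOp_apply]
    exact (mul_pos (PMF.toReal_apply_pos hac) hn).trans_le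
      ((K a).mul_le_mean (markovOp_pow_nonneg K n hf) c)

/-- If a closed set `D` stays reachable from every state reachable from `x`, then the probability
of being outside of `D` tends to zero. -/
theorem tendsto_markovOp_pow_compl {K : X → PMF X} {D : Set X}
    (hD : ∀ y ∈ D, ∀ z ∈ (K y).support, z ∈ D) {x : X}
    (hx : ∀ y, Reach K x y → ∃ z ∈ D, Reach K y z) :
    Tendsto (fun n => (markovOp K ^ n) (Dᶜ.indicator 1) x) atTop (𝓝 0) := by
  classical
  set f : X → ℝ := Dᶜ.indicator 1 with hf
  have hf0 : 0 ≤ f := Set.indicator_nonneg fun _ _ => zero_le_one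
  -- As `D` is closed, the indicator of its complement is superharmonic, so its iterates decrease to
  -- a limit `g`, which is harmonic.
  have hstep : markovOp K f ≤ f := by
    intro y
    by_cases hy : y ∈ D
    · rw [markovOp_apply, PMF.mean_congr (g := fun _ => 0), PMF.mean_const]
      · simp [hf, hy]
      · intro z hz
        simp [hf, hD y hy z hz]
    · rw [markovOp_apply]
      calc (K y).mean f ≤ (K y).mean (fun _ => 1) :=
            (K y).mean_mono fun z => Set.indicator_le_self' (fun _ _ => zero_le_one) z
        _ = f y := by simp [PMF.mean_const, hf, hy]
  have hanti : Antitone fun n => (markovOp K ^ n) f := antitone_nat_of_succ_le fun n => by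
    rw [pow_succ, Module.End.mul_apply]
    exact markovOp_pow_mono K n hstep
  have hlim : ∀ y, ∃ l, Tendsto (fun n => (markovOp K ^ n) f y) atTop (𝓝 l) := fun y =>
    ⟨_, tendsto_atTop_ciInf (fun _ _ h => hanti h y)
      ⟨0, by rintro _ ⟨n, rfl⟩; exact markovOp_pow_nonneg K n hf0 y⟩⟩
  choose g hg using hlim
  have hharm : ∀ y, g y = (K y).mean g := fun y => by
    refine tendsto_nhds_unique ((tendsto_add_atTop_iff_nat 1).2 (hg y)) ?_
    simp_rw [pow_succ', Module.End.mul_apply, markovOp_apply]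
    exact tendsto_finsetSum _ fun z _ => (hg z).const_mul _
  have hgD : ∀ y ∈ D, g y ≤ 0 := fun y hy =>
    le_of_tendsto (hg y) (Eventually.of_forall fun n => by
      simpa [hf, hy] using hanti (Nat.zero_le n) y)
  obtain ⟨c, hc, hmax⟩ := Set.exists_max_image {y | Reach K x y} g (Set.toFinite _) ⟨x, .refl⟩
  obtain ⟨d, hd, hcd⟩ := hx c hc
  -- By the maximum principle the maximum of `g` over the reachable states propagates along a path
  -- into `D`, where `g ≤ 0`.
  have hconst : g d = g c := by
    clear hd
    induction hcd with
    | refl => rfl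
    | @tail y z hy hz ih =>
      exact PMF.eq_of_le_mean (fun w hw => hmax w ((hc.trans hy).tail hw))
        (by rw [← hharm, ih]) hz
  have h1 : g x = 0 := le_antisymm ((hmax x .refl).trans (hconst ▸ hgD d hd))
    (ge_of_tendsto' (hg x) fun n => markovOp_pow_nonneg K n hf0 x)
  exact h1 ▸ hg x

/-- For nonnegative terms, shifting once gives at most `1 + 1/n` times the average at `n + 1`, which
contains one more term. -/
theorem tendsto_average_shift {e : ℕ → ℝ} (he : 0 ≤ e)
    (h : Tendsto (fun n : ℕ => (1 / (n : ℝ)) * ∑ i ∈ Finset.range (n + 1), e i) atTop (𝓝 0))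
    (j : ℕ) :
    Tendsto (fun n : ℕ => (1 / (n : ℝ)) * ∑ i ∈ Finset.range (n + 1), e (i + j)) atTop (𝓝 0) := by
  induction j with
  | zero => exact h
  | succ j ih =>
    have h1 := (tendsto_add_atTop_iff_nat 1).2 ih
    have h2 : Tendsto (fun n : ℕ => 1 + 1 / (n : ℝ)) atTop (𝓝 1) := by
      simpa using tendsto_one_div_atTop_nhds_zero_nat.const_add (1 : ℝ)
    have h3 := h2.mul h1
    rw [mul_zero] at h3
    refine tendsto_of_tendsto_of_tendsto_of_le_of_le' tendsto_const_nhds h3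
      (Eventually.of_forall fun n => mul_nonneg (by positivity)
        (Finset.sum_nonneg fun i _ => he _)) ?_
    filter_upwards [eventually_gt_atTop 0] with n hn
    have hn' : (0 : ℝ) < n := Nat.cast_pos.2 hn
    have h4 : (1 + 1 / (n : ℝ)) * (1 / ((n + 1 : ℕ) : ℝ)) = 1 / (n : ℝ) := by
      push_cast; field_simp
    rw [← mul_assoc, h4, Finset.sum_range_succ' _ (n + 1)]
    refine mul_le_mul_of_nonneg_left ?_ (by positivity)
    simp only [add_right_comm _ 1 j, ← add_assoc, zero_add]
    exact le_add_of_nonneg_right (he j)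

/-- The long-run average of a nonnegative function does not tend to zero if the function is
positive at a reachable recurrent state. -/
theorem not_tendsto_average_markovOp_pow {K : X → PMF X} {x c : X} (hxc : Reach K x c)
    (hc : Recurrent K c) {f : X → ℝ} (hf : 0 ≤ f) (hfc : 0 < f c) :
    ¬ Tendsto (fun n : ℕ => (1 / (n : ℝ)) * ∑ i ∈ Finset.range (n + 1), (markovOp K ^ i) f x)
      atTop (𝓝 0) := by
  classical
  intro hlim
  set C : Set X := {y | Reach K c y} with hC
  have hpos : ∀ y : X, ∃ n, y ∈ C → 0 < (markovOp K ^ n) f y := fun y => by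
    by_cases hy : y ∈ C
    · obtain ⟨n, hn⟩ := exists_markovOp_pow_pos (hc y hy) hf hfc
      exact ⟨n, fun _ => hn⟩
    · exact ⟨0, fun h => absurd h hy⟩
  choose j hj using hpos
  obtain ⟨N, hN⟩ := (Set.finite_range j).bddAbove
  -- The window `N + 1` is long enough for every state of the class `C` to see a positive value of
  -- `f`, so `F` has a positive minimum on `C`.
  set F : X → ℝ := ∑ i ∈ Finset.range (N + 1), (markovOp K ^ i) f with hF
  have hF0 : 0 ≤ F := Finset.sum_nonneg fun i _ => markovOp_pow_nonneg K i hf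
  have hFC : ∀ y ∈ C, 0 < F y := fun y hy => by
    rw [hF, Finset.sum_apply]
    exact (hj y hy).trans_le (Finset.single_le_sum
      (f := fun i => (markovOp K ^ i) f y) (fun i _ => markovOp_pow_nonneg K i hf y)
      (Finset.mem_range.2 (Nat.lt_succ_of_le (hN ⟨y, rfl⟩))))
  obtain ⟨y₀, hy₀, hmin⟩ := Set.exists_min_image C F (Set.toFinite _) ⟨c, .refl⟩
  set g : X → ℝ := C.indicator 1 with hg
  have hg0 : 0 ≤ g := Set.indicator_nonneg fun _ _ => zero_le_one
  have hgF : F y₀ • g ≤ F := fun y => by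
    by_cases hy : y ∈ C
    · simpa [hg, hy] using hmin y hy
    · simpa [hg, hy] using hF0 y
  have hgstep : g ≤ markovOp K g := fun y => by
    by_cases hy : y ∈ C
    · rw [markovOp_apply, PMF.mean_congr (g := fun _ => 1), PMF.mean_const]
      · simp [hg, hy]
      · intro z hz
        have : z ∈ C := Relation.ReflTransGen.tail hy hz
        simp [hg, this]
    · simpa [hg, hy] using markovOp_pow_nonneg K 1 hg0 y
  have hgmono : Monotone fun n => (markovOp K ^ n) g := monotone_nat_of_le_succ fun n => by
    rw [pow_succ, Module.End.mul_apply]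
    exact markovOp_pow_mono K n hgstep
  obtain ⟨k, hk⟩ := exists_markovOp_pow_pos hxc hg0 (by simp [hg, hC, Relation.ReflTransGen.refl])
  -- The mass in the closed class `C` never decreases and is positive at time `k`, so every window
  -- from time `k` on contributes at least a fixed positive amount; yet averages of finitely many
  -- shifts tend to `0`.
  have hlow : ∀ i, F y₀ * (markovOp K ^ k) g x ≤
      ∑ l ∈ Finset.range (N + 1), (markovOp K ^ (i + (k + l))) f x := fun i => by
    calc F y₀ * (markovOp K ^ k) g x ≤ F y₀ * (markovOp K ^ (k + i)) g x :=
          mul_le_mul_of_nonneg_left (hgmono (Nat.le_add_right k i) x) (hF0 y₀)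
      _ = (markovOp K ^ (k + i)) (F y₀ • g) x := by simp
      _ ≤ (markovOp K ^ (k + i)) F x := markovOp_pow_mono K _ hgF x
      _ = _ := by
        rw [hF, map_sum, Finset.sum_apply]
        refine Finset.sum_congr rfl fun l _ => ?_
        rw [← Module.End.mul_apply, ← pow_add, add_comm k i, add_assoc]
  have hsum := tendsto_finsetSum (Finset.range (N + 1)) fun l _ =>
    tendsto_average_shift (fun i => markovOp_pow_nonneg K i hf x) hlim (k + l)
  rw [Finset.sum_const_zero] at hsum
  have hq : 0 < F y₀ * (markovOp K ^ k) g x := mul_pos (hFC y₀ hy₀) hk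
  refine absurd (ge_of_tendsto hsum ?_) (not_le.2 hq)
  filter_upwards [eventually_gt_atTop 0] with n hn
  have hn' : (0 : ℝ) < n := Nat.cast_pos.2 hn
  rw [← Finset.mul_sum, Finset.sum_comm]
  calc F y₀ * (markovOp K ^ k) g x ≤ (1 / (n : ℝ)) *
        ∑ i ∈ Finset.range (n + 1), F y₀ * (markovOp K ^ k) g x := by
        rw [Finset.sum_const, Finset.card_range, nsmul_eq_mul, ← mul_assoc]
        refine le_mul_of_one_le_left hq.le ?_
        rw [one_div, inv_mul_eq_div, one_le_div hn']
        push_cast; linarith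
    _ ≤ _ := mul_le_mul_of_nonneg_left (Finset.sum_le_sum fun i _ => hlow i) (by positivity)

end FiniteChain

/-! ### The law of a run -/

namespace Strategy

variable {S A O M : Type*}

instance Config.finite [Finite S] [Finite M] [Finite A] : Finite (Config S M A) :=
  inferInstanceAs (Finite (S × M × A))

instance Config.discrete : DiscreteMeasurableSpace (Config S M A) := ⟨fun _ => trivial⟩

instance (G : POMDP S A O) (σ : Strategy M A O) (s : S) (m : M) :
    IsProbabilityMeasure (σ.runMeasure G s m) := by
  unfold runMeasure; infer_instance

theorem map_eval_zero_runMeasure (G : POMDP S A O) (σ : Strategy M A O) (s : S) (m : M) :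
    (σ.runMeasure G s m).map (fun ω => ω 0) = (σ.startLaw s m).toMeasure := by
  have h : (σ.runMeasure G s m).map (Preorder.frestrictLe (π := fun _ => Config S M A) 0) =
      (σ.startLaw s m).toMeasure.map (MeasurableEquiv.piUnique _).symm := by
    rw [runMeasure, Kernel.trajMeasure, Measure.map_comp _ _ (by fun_prop),
      Kernel.traj_map_frestrictLe, Kernel.partialTraj_self, Measure.id_comp]
  have h' := congrArg (Measure.map fun x => x ⟨0, Finset.mem_Iic.2 le_rfl⟩) h
  rw [Measure.map_map (by fun_prop) (by fun_prop), Measure.map_map (by fun_prop) (by fun_prop)] at h'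
  refine h'.trans ?_
  have hid : (fun x : (Finset.Iic 0 → Config S M A) => x ⟨0, Finset.mem_Iic.2 le_rfl⟩) ∘
      (MeasurableEquiv.piUnique fun _ : Finset.Iic 0 => Config S M A).symm = id := by
    ext c : 1
    exact (MeasurableEquiv.piUnique fun _ : Finset.Iic 0 => Config S M A).apply_symm_apply c
  exact (congrArg (fun g => Measure.map g (σ.startLaw s m).toMeasure) hid).trans Measure.map_id

/-- The Markov property in integrated form: the kernel from histories sees only their last instant.
Both the one-time laws and the almost sure support statement rest on it. -/
theorem lintegral_pair_runMeasure (G : POMDP S A O) (σ : Strategy M A O) (s : S) (m : M) (n : ℕ)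
    (f : Config S M A → Config S M A → ENNReal) (hf : Measurable (Function.uncurry f)) :
    ∫⁻ ω, f (ω n) (ω (n + 1)) ∂(σ.runMeasure G s m) =
      ∫⁻ ω, ∫⁻ c, f (ω n) c ∂(σ.stepLaw G (ω n)).toMeasure ∂(σ.runMeasure G s m) := by
  have h := Kernel.map_frestrictLe_trajMeasure_compProd_eq_map_trajMeasure
    (X := fun _ => Config S M A) (μ₀ := (σ.startLaw s m).toMeasure) (κ := σ.stepKernel G) (a := n)
  have hF : Measurable fun z : (Finset.Iic n → Config S M A) × Config S M A =>
      f (z.1 ⟨n, Finset.mem_Iic.2 le_rfl⟩) z.2 := by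
    have : Measurable fun z : (Finset.Iic n → Config S M A) × Config S M A =>
        (z.1 ⟨n, Finset.mem_Iic.2 le_rfl⟩, z.2) := by fun_prop
    exact hf.comp this
  have h' := congrArg (fun μ => ∫⁻ z, f (z.1 ⟨n, Finset.mem_Iic.2 le_rfl⟩) z.2 ∂μ) h
  beta_reduce at h'
  rw [Measure.lintegral_compProd hF, lintegral_map hF.lintegral_kernel_prod_right' (by fun_prop),
    lintegral_map hF (by fun_prop)] at h'
  exact h'.symm

/-- Almost surely, every instant of a run is a possible successor of the previous one. -/
theorem ae_mem_support_stepLaw [Finite S] [Finite M] [Finite A] (G : POMDP S A O)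
    (σ : Strategy M A O) (s : S) (m : M) :
    ∀ᵐ ω ∂(σ.runMeasure G s m), ∀ n, ω (n + 1) ∈ (σ.stepLaw G (ω n)).support := by
  rw [ae_all_iff]
  intro n
  have hB : MeasurableSet {z : Config S M A × Config S M A | z.2 ∉ (σ.stepLaw G z.1).support} :=
    .of_discrete
  have h := σ.lintegral_pair_runMeasure G s m n
    (fun c d => {z : Config S M A × Config S M A | z.2 ∉ (σ.stepLaw G z.1).support}.indicator 1
      (c, d)) (measurable_one.indicator hB)
  have h0 : ∀ c : Config S M A, ∫⁻ d, {z : Config S M A × Config S M A |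
      z.2 ∉ (σ.stepLaw G z.1).support}.indicator 1 (c, d) ∂(σ.stepLaw G c).toMeasure = 0 := by
    intro c
    have : (fun d => {z : Config S M A × Config S M A |
        z.2 ∉ (σ.stepLaw G z.1).support}.indicator (1 : Config S M A × Config S M A → ENNReal) (c, d)) =
        ((σ.stepLaw G c).supportᶜ).indicator 1 := rfl
    rw [this, lintegral_indicator_one .of_discrete, PMF.toMeasure_apply_eq_zero_iff _ .of_discrete]
    exact disjoint_compl_right
  simp only [h0, lintegral_zero] at h
  have hm : Measurable fun ω : ℕ → Config S M A => (ω n, ω (n + 1)) := by fun_prop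
  rw [ae_iff]
  exact (lintegral_indicator_one (hm hB)).symm.trans h

variable [Fintype S] [Fintype M] [Fintype A]

instance Config.fintype : Fintype (Config S M A) := inferInstanceAs (Fintype (S × M × A))

theorem map_eval_succ_runMeasure (G : POMDP S A O) (σ : Strategy M A O) (s : S) (m : M) (n : ℕ)
    {p : PMF (Config S M A)} (h : (σ.runMeasure G s m).map (fun ω => ω n) = p.toMeasure) :
    (σ.runMeasure G s m).map (fun ω => ω (n + 1)) = (p.bind (σ.stepLaw G)).toMeasure := by
  ext B hB
  have h1 := σ.lintegral_pair_runMeasure G s m n (fun _ c => B.indicator 1 c)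
    ((measurable_one.indicator hB).comp measurable_snd)
  simp only [lintegral_indicator_one hB] at h1
  have h2 : Measurable fun c => (σ.stepLaw G c).toMeasure B := .of_discrete
  have hn : ∀ k, Measurable fun ω : ℕ → Config S M A => ω k := fun k => measurable_pi_apply k
  have h3 := lintegral_map (μ := σ.runMeasure G s m) h2 (hn n)
  have h4 := lintegral_map (μ := σ.runMeasure G s m) (measurable_one.indicator hB) (hn (n + 1))
  rw [h4.trans (h1.trans h3.symm) |> (lintegral_indicator_one hB).symm.trans, h,
    lintegral_countable', PMF.toMeasure_bind_apply _ _ _ hB]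
  refine tsum_congr fun c => ?_
  rw [PMF.toMeasure_apply_singleton _ _ (.singleton c), mul_comm]

theorem startLaw_mean (σ : Strategy M A O) (s : S) (m : M) (f : Config S M A → ℝ) :
    (σ.startLaw s m).mean f = (σ.act m).mean fun a => f (s, m, a) := PMF.mean_map _ _ _

/-- Intertwining of the process on configurations with actions and the chain on `S × M`, in which
the action is integrated out. -/
theorem startLaw_mean_stepLaw_mean (G : POMDP S A O) (σ : Strategy M A O) (x : S × M)
    (f : Config S M A → ℝ) :
    (σ.startLaw x.1 x.2).mean (fun c => (σ.stepLaw G c).mean f) =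
      (σ.chain G x).mean fun y => (σ.startLaw y.1 y.2).mean f := by
  simp only [startLaw_mean, stepLaw, chain, PMF.mean_map, PMF.mean_bind]

theorem integral_eval_runMeasure (G : POMDP S A O) (σ : Strategy M A O) (s : S) (m : M) (n : ℕ)
    (f : Config S M A → ℝ) :
    ∫ ω, f (ω n) ∂(σ.runMeasure G s m) =
      (FiniteChain.markovOp (σ.chain G) ^ n) (fun x => (σ.startLaw x.1 x.2).mean f) (s, m) := by
  -- All test functions are treated at once, because the induction step applies the hypothesis to
  -- the one-step mean of `f`.
  have key : ∃ p : PMF (Config S M A), (σ.runMeasure G s m).map (fun ω => ω n) = p.toMeasure ∧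
      ∀ f, p.mean f = (FiniteChain.markovOp (σ.chain G) ^ n)
        (fun x => (σ.startLaw x.1 x.2).mean f) (s, m) := by
    clear f
    induction n with
    | zero => exact ⟨_, σ.map_eval_zero_runMeasure G s m, fun f => rfl⟩
    | succ n ih =>
      obtain ⟨p, hp, hf⟩ := ih
      refine ⟨_, σ.map_eval_succ_runMeasure G s m n hp, fun f => ?_⟩
      rw [PMF.mean_bind, hf, pow_succ, Module.End.mul_apply]
      simp_rw [startLaw_mean_stepLaw_mean]
      rfl
  obtain ⟨p, hp, hf⟩ := key
  have hn : Measurable fun ω : ℕ → Config S M A => ω n := measurable_pi_apply n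
  have h := integral_map (μ := σ.runMeasure G s m) hn.aemeasurable (f := f)
    Measurable.of_discrete.aestronglyMeasurable
  rw [← hf, ← h, hp, PMF.integral_eq_sum]
  rfl

end Strategy

/-! ### The limit-average objective -/

section LimAvg

variable {S A : Type*}

/-- The averages are at most `(n + 1) / n`, because `n + 1` rewards are divided by `n`. Hence a
lower limit of `1` is a genuine limit. -/
theorem tendsto_average_loss {r : S → A → unitInterval} {ρ : Play S A} (h : limAvg r ρ = 1) :
    Tendsto (fun n : ℕ => (1 / (n : ℝ)) *
      ∑ i ∈ Finset.range (n + 1), (1 - (r (ρ i).1 (ρ i).2 : ℝ))) atTop (𝓝 0) := by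
  set a : ℕ → ℝ := fun n => (1 / (n : ℝ)) * ∑ i ∈ Finset.range (n + 1), (r (ρ i).1 (ρ i).2 : ℝ)
    with ha
  have hb : Tendsto (fun n : ℕ => (1 / (n : ℝ)) * (n + 1)) atTop (𝓝 1) := by
    have h1 : Tendsto (fun n : ℕ => 1 + 1 / (n : ℝ)) atTop (𝓝 (1 + 0)) :=
      tendsto_one_div_atTop_nhds_zero_nat.const_add (1 : ℝ)
    rw [add_zero] at h1
    refine h1.congr' ?_
    filter_upwards [eventually_gt_atTop 0] with n hn
    have hn' : (n : ℝ) ≠ 0 := Nat.cast_ne_zero.2 hn.ne'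
    field_simp
  have hab : ∀ n : ℕ, a n ≤ (1 / (n : ℝ)) * (n + 1) := fun n => by
    refine mul_le_mul_of_nonneg_left ?_ (by positivity)
    calc _ ≤ ∑ i ∈ Finset.range (n + 1), (1 : ℝ) :=
          Finset.sum_le_sum fun i _ => (r (ρ i).1 (ρ i).2).2.2
      _ = n + 1 := by simp
  have hlim : Tendsto a atTop (𝓝 1) := by
    refine tendsto_order.2 ⟨fun b hb => eventually_lt_of_lt_liminf (hb.trans_eq h.symm) ?_,
      fun b hb' => ?_⟩
    · exact isBoundedUnder_of ⟨0, fun n => mul_nonneg (by positivity)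
        (Finset.sum_nonneg fun i _ => (r (ρ i).1 (ρ i).2).2.1)⟩
    · filter_upwards [(tendsto_order.1 hb).2 b hb'] with n hn using (hab n).trans_lt hn
  have := hb.sub hlim
  rw [sub_self] at this
  refine this.congr fun n => ?_
  rw [ha, ← mul_sub, Finset.sum_sub_distrib]
  simp

theorem limAvg_eq_one_of_eventually {r : S → A → unitInterval} {ρ : Play S A} {N : ℕ}
    (h : ∀ n, N ≤ n → r (ρ n).1 (ρ n).2 = 1) : limAvg r ρ = 1 := by
  have hu : Tendsto (fun n => (r (ρ n).1 (ρ n).2 : ℝ)) atTop (𝓝 1) :=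
    tendsto_const_nhds.congr' <| by
      filter_upwards [eventually_ge_atTop N] with n hn
      simp [h n hn]
  have h1 := hu.cesaro.add (tendsto_one_div_atTop_nhds_zero_nat.mul hu)
  rw [zero_mul, add_zero] at h1
  refine Tendsto.liminf_eq (h1.congr fun n => ?_)
  rw [Finset.sum_range_succ, mul_add, one_div]

theorem measurableSet_limAvgOne (r : S → A → unitInterval) : MeasurableSet (limAvgOne r) := by
  have h : ∀ i, Measurable fun ρ : Play S A => (r (ρ i).1 (ρ i).2 : ℝ) := fun i => by
    let _ : MeasurableSpace (S × A) := ⊤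
    exact (measurable_from_top (f := fun c : S × A => (r c.1 c.2 : ℝ))).comp
      (measurable_pi_apply i)
  have hm : Measurable (limAvg r) :=
    Measurable.liminf fun n => (Finset.measurable_sum _ fun i _ => h i).const_mul _
  exact hm (measurableSet_singleton 1)

end LimAvg

/-! ### The combinatorial winning criterion -/

namespace Strategy

open FiniteChain

variable {S A O M : Type*}

theorem playMeasure_limAvgOne_eq_one_iff_ae (G : POMDP S A O) (r : S → A → unitInterval)
    (σ : Strategy M A O) (s : S) (m : M) :
    σ.playMeasure G s m (limAvgOne r) = 1 ↔
      ∀ᵐ ω ∂(σ.runMeasure G s m), limAvg r (playOf ω) = 1 := by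
  rw [playMeasure, Measure.map_apply measurable_playOf (measurableSet_limAvgOne r),
    ← mem_ae_iff_prob_eq_one (measurable_playOf (measurableSet_limAvgOne r))]
  rfl

theorem mem_support_startLaw {σ : Strategy M A O} {s : S} {m : M} {c : Config S M A} :
    c ∈ (σ.startLaw s m).support ↔ c.1 = s ∧ c.2.1 = m ∧ c.2.2 ∈ (σ.act m).support := by
  obtain ⟨s', m', a⟩ := c
  refine (PMF.mem_support_map_iff _ _ _).trans ?_
  constructor
  · rintro ⟨b, hb, h⟩
    cases h
    exact ⟨rfl, rfl, hb⟩
  · rintro ⟨h1, h2, h3⟩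
    exact ⟨a, h3, by rw [← show s' = s from h1, ← show m' = m from h2]⟩

theorem mem_support_chain {G : POMDP S A O} {σ : Strategy M A O} {x y : S × M} :
    y ∈ (σ.chain G x).support ↔ ∃ a ∈ (σ.act x.2).support, y.1 ∈ (G.trans x.1 a).support ∧
      y.2 ∈ (σ.update x.2 (G.obs y.1) a).support := by
  obtain ⟨s, m⟩ := y
  simp only [chain, PMF.mem_support_bind_iff, PMF.mem_support_map_iff, Prod.mk.injEq]
  constructor
  · rintro ⟨a, ha, s', hs, m', hm, rfl, rfl⟩
    exact ⟨a, ha, hs, hm⟩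
  · rintro ⟨a, ha, hs, hm⟩
    exact ⟨a, ha, s, hs, m, hm, rfl, rfl⟩

theorem mem_support_stepLaw {G : POMDP S A O} {σ : Strategy M A O} {c d : Config S M A} :
    d ∈ (σ.stepLaw G c).support ↔ d.1 ∈ (G.trans c.1 c.2.2).support ∧
      d.2.1 ∈ (σ.update c.2.1 (G.obs d.1) c.2.2).support ∧ d.2.2 ∈ (σ.act d.2.1).support := by
  simp only [stepLaw, PMF.mem_support_bind_iff, mem_support_startLaw]
  constructor
  · rintro ⟨s, hs, m, hm, rfl, rfl, ha⟩
    exact ⟨hs, hm, ha⟩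
  · rintro ⟨hs, hm, ha⟩
    exact ⟨_, hs, _, hm, rfl, rfl, ha⟩

theorem recur_iff {G : POMDP S A O} {σ : Strategy M A O} {s : S} {m : M} :
    s ∈ σ.recur G m ↔ Recurrent (σ.chain G) (s, m) := by
  constructor
  · rintro ⟨C, ⟨-, hC, hclosed⟩, hs⟩ y hy
    refine hC y ?_ _ hs
    clear hC
    induction hy with
    | refl => exact hs
    | tail _ h ih => exact hclosed _ ih _ h
  · intro h
    exact ⟨{y | Reach (σ.chain G) (s, m) y}, ⟨⟨_, .refl⟩, fun x hx y hy => (h x hx).trans hy,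
      fun x hx y hy => hx.tail hy⟩, .refl⟩

/-- The expected loss of a winning strategy tends to `0` on average. -/
theorem tendsto_average_expected_loss [Fintype S] [Fintype M] [Fintype A] {G : POMDP S A O}
    {r : S → A → unitInterval} {σ : Strategy M A O} {s : S} {m : M}
    (h : σ.playMeasure G s m (limAvgOne r) = 1) :
    Tendsto (fun n : ℕ => (1 / (n : ℝ)) * ∑ i ∈ Finset.range (n + 1),
      (markovOp (σ.chain G) ^ i) (fun x => (σ.startLaw x.1 x.2).mean
        fun c => 1 - (r c.1 c.2.2 : ℝ)) (s, m)) atTop (𝓝 0) := by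
  rw [playMeasure_limAvgOne_eq_one_iff_ae] at h
  set μ := σ.runMeasure G s m with hμ
  have hl0 : ∀ c : Config S M A, (0 : ℝ) ≤ 1 - r c.1 c.2.2 := fun c =>
    sub_nonneg.2 (r c.1 c.2.2).2.2
  have hl1 : ∀ c : Config S M A, (1 : ℝ) - r c.1 c.2.2 ≤ 1 := fun c =>
    sub_le_self _ (r c.1 c.2.2).2.1
  have hI : ∀ i, ∫ ω, 1 - (r (ω i).1 (ω i).2.2 : ℝ) ∂μ = (markovOp (σ.chain G) ^ i)
      (fun x => (σ.startLaw x.1 x.2).mean fun c => 1 - (r c.1 c.2.2 : ℝ)) (s, m) := fun i =>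
    σ.integral_eval_runMeasure G s m i fun c => 1 - (r c.1 c.2.2 : ℝ)
  generalize hloss : (fun c : Config S M A => 1 - (r c.1 c.2.2 : ℝ)) = loss at hI
  have hlc : ∀ c : Config S M A, 1 - (r c.1 c.2.2 : ℝ) = loss c := congrFun hloss
  have hpt : ∀ᵐ ω ∂μ, Tendsto (fun n : ℕ => (1 / (n : ℝ)) *
      ∑ i ∈ Finset.range (n + 1), loss (ω i)) atTop (𝓝 0) := by
    filter_upwards [h] with ω hω
    have h1 := tendsto_average_loss hω
    simp_rw [← hlc]
    exact h1
  simp_rw [hlc] at hI hl0 hl1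
  have hmeas : ∀ i, Measurable fun ω : ℕ → Config S M A => loss (ω i) := fun i =>
    (Measurable.of_discrete (f := loss)).comp (measurable_pi_apply i)
  have hint : ∀ i, Integrable (fun ω : ℕ → Config S M A => loss (ω i)) μ := fun i =>
    Integrable.of_bound (hmeas i).aestronglyMeasurable 1 (Eventually.of_forall fun ω => by
      rw [Real.norm_of_nonneg (hl0 _)]; exact hl1 _)
  -- The bound is `(n + 1) / n ≤ 2` for `n ≥ 1`; at `n = 0` the factor `1 / 0` is `0`.
  have hbound : ∀ (n : ℕ) (ω : ℕ → Config S M A),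
      ‖(1 / (n : ℝ)) * ∑ i ∈ Finset.range (n + 1), loss (ω i)‖ ≤ 2 := fun n ω => by
    rw [Real.norm_of_nonneg (mul_nonneg (by positivity) (Finset.sum_nonneg fun i _ => hl0 _))]
    rcases Nat.eq_zero_or_pos n with rfl | hn
    · simp
    · have hn' : (1 : ℝ) ≤ n := Nat.one_le_cast.2 hn
      rw [one_div, inv_mul_le_iff₀ (by linarith)]
      calc _ ≤ ∑ i ∈ Finset.range (n + 1), (1 : ℝ) := Finset.sum_le_sum fun i _ => hl1 _
        _ ≤ _ := by simp; linarith
  have hconv := tendsto_integral_of_dominated_convergence (μ := μ) (fun _ => (2 : ℝ))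
    (fun n => ((Finset.measurable_sum (Finset.range (n + 1)) fun i _ => hmeas i).const_mul
      (1 / (n : ℝ))).aestronglyMeasurable)
    (integrable_const _) (fun n => Eventually.of_forall (hbound n)) hpt
  rw [integral_zero] at hconv
  refine hconv.congr fun n => ?_
  rw [integral_const_mul, integral_finsetSum _ fun i _ => hint i]
  simp_rw [hI]

variable [Finite S] [Finite M] [Finite A]

/-- A strategy wins if a closed set of configurations with reward `1` stays reachable. -/
theorem playMeasure_limAvgOne_eq_one_of_closed {G : POMDP S A O} {r : S → A → unitInterval}
    {σ : Strategy M A O} {s : S} {m : M} {D : Set (S × M)}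
    (hclosed : ∀ x ∈ D, ∀ y ∈ (σ.chain G x).support, y ∈ D)
    (hD : ∀ x ∈ D, ∀ a ∈ (σ.act x.2).support, r x.1 a = 1)
    (hreach : ∀ y, Reach (σ.chain G) (s, m) y → ∃ z ∈ D, Reach (σ.chain G) y z) :
    σ.playMeasure G s m (limAvgOne r) = 1 := by
  classical
  cases nonempty_fintype S; cases nonempty_fintype M; cases nonempty_fintype A
  rw [playMeasure_limAvgOne_eq_one_iff_ae]
  set μ := σ.runMeasure G s m with hμ
  let E : ℕ → Set (ℕ → Config S M A) := fun n => {ω | ((ω n).1, (ω n).2.1) ∉ D}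
  have hE : ∀ n, MeasurableSet (E n) := fun n =>
    (MeasurableSet.of_discrete (s := {c : Config S M A | (c.1, c.2.1) ∉ D})).preimage
      (measurable_pi_apply n)
  have hprob : ∀ n, μ.real (E n) = (markovOp (σ.chain G) ^ n) (Dᶜ.indicator 1) (s, m) := by
    intro n
    have h := σ.integral_eval_runMeasure G s m n
      (fun c => {c : Config S M A | (c.1, c.2.1) ∉ D}.indicator 1 c)
    have h1 : (fun x : S × M => (σ.startLaw x.1 x.2).mean
        (fun c => {c : Config S M A | (c.1, c.2.1) ∉ D}.indicator (1 : Config S M A → ℝ) c)) =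
        Dᶜ.indicator 1 := by
      ext x
      rw [startLaw_mean]
      exact PMF.mean_const (σ.act x.2) (Dᶜ.indicator 1 x)
    rw [h1] at h
    rw [← h, ← integral_indicator_one (hE n)]
    rfl
  have hlim := tendsto_markovOp_pow_compl hclosed hreach
  simp_rw [← hprob] at hlim
  -- The index is `n + 1` because the support statement for steps controls the action only from
  -- instant `1` on.
  have hhit : ∀ᵐ ω ∂μ, ∃ n, ((ω (n + 1)).1, (ω (n + 1)).2.1) ∈ D := by
    rw [ae_iff, ← measureReal_eq_zero_iff]
    refine le_antisymm (ge_of_tendsto' ((tendsto_add_atTop_iff_nat 1).2 hlim) fun n => ?_)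
      measureReal_nonneg
    exact measureReal_mono fun ω hω => fun h => hω ⟨n, h⟩
  filter_upwards [hhit, σ.ae_mem_support_stepLaw G s m] with ω ⟨N, hN⟩ hstep
  have hact : ∀ n, (ω (n + 1)).2.2 ∈ (σ.act (ω (n + 1)).2.1).support := fun n =>
    (mem_support_stepLaw.1 (hstep n)).2.2
  have hstay : ∀ n, N ≤ n → ((ω (n + 1)).1, (ω (n + 1)).2.1) ∈ D := by
    intro n hn
    induction n, hn using Nat.le_induction with
    | base => exact hN
    | succ n _ ih =>
      have h := mem_support_stepLaw.1 (hstep (n + 1))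
      exact hclosed _ ih _ (mem_support_chain.2 ⟨_, hact n, h.1, h.2.1⟩)
  refine limAvg_eq_one_of_eventually (N := N + 1) fun n hn => ?_
  obtain ⟨n, rfl⟩ : ∃ k, n = k + 1 := ⟨n - 1, by omega⟩
  exact hD _ (hstay n (by omega)) _ (hact n)

/-- A strategy is winning iff all rewards in the reachable recurrent classes are `1`. -/
theorem playMeasure_limAvgOne_eq_one_iff {G : POMDP S A O} {r : S → A → unitInterval}
    {σ : Strategy M A O} {s : S} {m : M} :
    σ.playMeasure G s m (limAvgOne r) = 1 ↔ ∀ y, Reach (σ.chain G) (s, m) y →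
      Recurrent (σ.chain G) y → ∀ a ∈ (σ.act y.2).support, r y.1 a = 1 := by
  constructor
  · intro h y hy hrec a ha
    cases nonempty_fintype S; cases nonempty_fintype M; cases nonempty_fintype A
    by_contra hne
    have hlt : (r y.1 a : ℝ) < 1 :=
      lt_of_le_of_ne (r y.1 a).2.2 fun h => hne (Subtype.ext h)
    have hl0 : (0 : Config S M A → ℝ) ≤ fun c => 1 - (r c.1 c.2.2 : ℝ) := fun c =>
      sub_nonneg.2 (r c.1 c.2.2).2.2
    refine not_tendsto_average_markovOp_pow hy hrec (fun x => Finset.sum_nonneg fun c _ =>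
      mul_nonneg ENNReal.toReal_nonneg (hl0 c)) ?_ (tendsto_average_expected_loss h)
    have h1 := (σ.startLaw y.1 y.2).mul_le_mean hl0 ((y.1, y.2, a) : S × M × A)
    refine lt_of_lt_of_le (mul_pos (PMF.toReal_apply_pos ?_) (sub_pos.2 hlt)) h1
    exact mem_support_startLaw.2 ⟨rfl, rfl, ha⟩
  · intro h
    refine playMeasure_limAvgOne_eq_one_of_closed
      (D := {y | Reach (σ.chain G) (s, m) y ∧ Recurrent (σ.chain G) y})
      (fun x hx y hy => ⟨hx.1.tail hy, hx.2.of_reach (.single hy)⟩)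
      (fun x hx => h x hx.1 hx.2) fun y hy => ?_
    obtain ⟨z, hz, hrec⟩ := exists_reach_recurrent (σ.chain G) y
    exact ⟨z, ⟨hy.trans hz, hrec⟩, hz⟩

end Strategy

/-! ### The collapsed strategy -/

namespace Strategy

open FiniteChain

theorem support_uniformOr {α : Type*} [Finite α] {s : Set α} (hs : s.Nonempty) (d : α) :
    (uniformOr s d).support = s := by
  have h : s.toFinite.toFinset.Nonempty := by simpa using hs
  rw [uniformOr, dif_pos h, PMF.support_uniformOfFinset]
  simp

variable {S A O M : Type*} {G : POMDP S A O} {r : S → A → unitInterval} {σ : Strategy M A O}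

/-- The winning criterion speaks of all reachable configurations, and a successor reaches no new
ones. -/
theorem mem_win_of_mem_support_chain [Finite S] [Finite A] [Finite M] {x y : S × M}
    (hx : x.1 ∈ σ.win G r x.2) (h : y ∈ (σ.chain G x).support) : y.1 ∈ σ.win G r y.2 := by
  have hx' := playMeasure_limAvgOne_eq_one_iff.1 hx
  exact playMeasure_limAvgOne_eq_one_iff.2 fun z hz => hx' z (hz.head h)

theorem mem_recur_of_mem_support_chain {x y : S × M}
    (hx : x.1 ∈ σ.recur G x.2) (h : y ∈ (σ.chain G x).support) : y.1 ∈ σ.recur G y.2 :=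
  recur_iff.2 ((recur_iff.1 hx).of_reach (.single h))

theorem card_collapsedMemory_le [Finite S] [Finite A] :
    Nat.card (σ.CollapsedMemory G r) ≤ 2 ^ (3 * Nat.card S + Nat.card A) := by
  classical
  cases nonempty_fintype S; cases nonempty_fintype A
  refine (Nat.card_le_card_of_injective (Subtype.val : σ.CollapsedMemory G r → _)
    Subtype.val_injective).trans_eq ?_
  simp only [Nat.card_eq_fintype_card, Fintype.card_prod, Fintype.card_set]
  ring

/-- The updated belief contains the actual next state, so it is nonempty. Hence the fallbacks of
`uniformOr` do not occur while the state lies in the belief. -/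
theorem exists_collapsedEdge {x : S × σ.CollapsedMemory G r} (hx : x.1 ∈ x.2.1.1) {m m' : M}
    {a : A} {s : S} (hm : x.2.1.2 = σ.label G r m) (ha : a ∈ (σ.act m).support)
    (hs : s ∈ (G.trans x.1 a).support) (hm' : m' ∈ (σ.update m (G.obs s) a).support) :
    ∃ w : σ.CollapsedMemory G r, s ∈ w.1.1 ∧ w.1.2 = σ.label G r m' ∧
      σ.CollapsedEdge G r x.2 a w ∧ w.1.1 ⊆ G.obs ⁻¹' {G.obs s} := by
  have hmem : s ∈ G.beliefUpdate x.2.1.1 a (G.obs s) := ⟨Set.mem_biUnion hx hs, rfl⟩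
  exact ⟨⟨(G.beliefUpdate x.2.1.1 a (G.obs s), σ.label G r m'), m', rfl⟩, hmem, rfl,
    ⟨m, m', _, hm, rfl, ha, ⟨s, hmem⟩, rfl, hm'⟩, Set.inter_subset_right⟩

/-- The states compatible with a vertex of the collapsed graph: the state lies in the belief, and
all states of the belief are winning. -/
def Consistent (x : S × σ.CollapsedMemory G r) : Prop :=
  x.1 ∈ x.2.1.1 ∧ x.2.1.1 ⊆ x.2.1.2.1

variable [Finite S] [Finite A]

theorem collapse_simulates {x : S × σ.CollapsedMemory G r} (hx : x.1 ∈ x.2.1.1) {m : M}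
    (hm : x.2.1.2 = σ.label G r m) {z : S × M} (hz : z ∈ (σ.chain G (x.1, m)).support) :
    ∃ w : σ.CollapsedMemory G r, z.1 ∈ w.1.1 ∧ w.1.2 = σ.label G r z.2 ∧
      (z.1, w) ∈ ((σ.collapse G r).chain G x).support := by
  obtain ⟨a, ha, hs, hm'⟩ := mem_support_chain.1 hz
  obtain ⟨w, hw, hl, he, hsub⟩ := exists_collapsedEdge hx hm ha hs hm'
  refine ⟨w, hw, hl, mem_support_chain.2 ⟨a, ?_, hs, ?_⟩⟩
  · exact (support_uniformOr (s := {a | ∃ w, σ.CollapsedEdge G r x.2 a w}) ⟨a, w, he⟩ _).symm.subset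
      ⟨w, he⟩
  · exact (support_uniformOr (s := {w | σ.CollapsedEdge G r x.2 a w ∧ w.1.1 ⊆ G.obs ⁻¹' {G.obs z.1}})
      ⟨w, he, hsub⟩ _).symm.subset ⟨he, hsub⟩

theorem mem_support_collapse_act {x : S × σ.CollapsedMemory G r} (hx : x.1 ∈ x.2.1.1) {a : A}
    (ha : a ∈ ((σ.collapse G r).act x.2).support) :
    ∃ m, x.2.1.2 = σ.label G r m ∧ a ∈ (σ.act m).support := by
  obtain ⟨m, hm⟩ := x.2.2
  obtain ⟨b, hb⟩ := (σ.act m).support_nonempty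
  obtain ⟨s, hs⟩ := (G.trans x.1 b).support_nonempty
  obtain ⟨m', hm'⟩ := (σ.update m (G.obs s) b).support_nonempty
  obtain ⟨w, -, -, he, -⟩ := exists_collapsedEdge hx hm hb hs hm'
  have h := (support_uniformOr (s := {a | ∃ w, σ.CollapsedEdge G r x.2 a w}) ⟨b, w, he⟩ _).subset ha
  obtain ⟨-, m, -, -, hm, -, ha, -⟩ := h
  exact ⟨m, hm, ha⟩

/-- A step of the collapsed strategy comes from a step of the original one. -/
theorem exists_chain_of_collapse {x y : S × σ.CollapsedMemory G r} (hx : x.1 ∈ x.2.1.1)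
    (h : y ∈ ((σ.collapse G r).chain G x).support) :
    y.1 ∈ y.2.1.1 ∧ ∃ m m' : M, x.2.1.2 = σ.label G r m ∧ y.2.1.2 = σ.label G r m' ∧
      (∀ s ∈ y.2.1.1, ∃ t ∈ x.2.1.1, (s, m') ∈ (σ.chain G (t, m)).support) ∧
      (y.1, m') ∈ (σ.chain G (x.1, m)).support := by
  obtain ⟨a, ha, hs, hw⟩ := mem_support_chain.1 h
  obtain ⟨m₀, hm₀, ha₀⟩ := mem_support_collapse_act hx ha
  obtain ⟨m₁, hm₁⟩ := (σ.update m₀ (G.obs y.1) a).support_nonempty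
  obtain ⟨w, -, -, he, hsub⟩ := exists_collapsedEdge hx hm₀ ha₀ hs hm₁
  obtain ⟨⟨m, m', o, hm, hm', ha', ⟨t, ht⟩, hY, hu⟩, hsub'⟩ := (support_uniformOr
    (s := {w | σ.CollapsedEdge G r x.2 a w ∧ w.1.1 ⊆ G.obs ⁻¹' {G.obs y.1}})
    ⟨w, he, hsub⟩ _).subset hw
  -- The nonempty new belief lies in the fibres of both observations.
  have ho : o = G.obs y.1 := (hY.subset ht).2.symm.trans (hsub' ht)
  subst ho
  refine ⟨hY.symm.subset ⟨Set.mem_biUnion hx hs, rfl⟩, m, m', hm, hm', fun s hs => ?_,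
    mem_support_chain.2 ⟨a, ha', hs, hu⟩⟩
  obtain ⟨h1, h2⟩ := hY.subset hs
  obtain ⟨t, ht, hst⟩ := Set.mem_iUnion₂.1 h1
  refine ⟨t, ht, mem_support_chain.2 ⟨a, ha', hst, ?_⟩⟩
  rwa [show G.obs s = G.obs y.1 from h2]

variable [Finite M]

/-- One pair `m`, `m'` serves the whole belief: each state of the new belief has a predecessor in
the old one, winning with `m` because the label carries the winning set of `m`. -/
theorem Consistent.of_mem_support {x y : S × σ.CollapsedMemory G r} (hx : Consistent x)
    (h : y ∈ ((σ.collapse G r).chain G x).support) : Consistent y := by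
  obtain ⟨hy, m, m', hm, hm', hall, -⟩ := exists_chain_of_collapse hx.1 h
  refine ⟨hy, fun s hs => ?_⟩
  obtain ⟨t, ht, hst⟩ := hall s hs
  have h1 : x.2.1.2.1 = σ.win G r m := congrArg Prod.fst hm
  have h2 : y.2.1.2.1 = σ.win G r m' := congrArg Prod.fst hm'
  rw [h2]
  exact mem_win_of_mem_support_chain (x := (t, m)) (y := (s, m')) (h1 ▸ hx.2 ht : t ∈ σ.win G r m)
    hst

theorem AlmostSureWinning.collapse (h : σ.AlmostSureWinning G r) :
    (σ.collapse G r).AlmostSureWinning G r := by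
  refine playMeasure_limAvgOne_eq_one_of_closed
    (D := {x | Consistent x ∧ x.1 ∈ x.2.1.2.2.1}) ?_ ?_ ?_
  · rintro x ⟨hx, hrec⟩ y hy
    refine ⟨hx.of_mem_support hy, ?_⟩
    obtain ⟨-, m, m', hm, hm', -, hc⟩ := exists_chain_of_collapse hx.1 hy
    rw [hm] at hrec
    rw [hm']
    exact mem_recur_of_mem_support_chain (x := (x.1, m)) hrec hc
  · rintro x ⟨hx, hrec⟩ a ha
    obtain ⟨m, hm, ha⟩ := mem_support_collapse_act hx.1 ha
    have hwin := hx.2 hx.1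
    rw [hm] at hrec hwin
    exact playMeasure_limAvgOne_eq_one_iff.1 hwin _ .refl (recur_iff.1 hrec) a ha
  · intro y hy
    have hcons : Consistent y := by
      induction hy with
      | refl => exact ⟨rfl, by rintro _ rfl; exact h⟩
      | tail _ he ih => exact ih.of_mem_support he
    clear hy
    obtain ⟨m, hm⟩ := y.2.2
    -- Any memory with the current label will do: its path into a recurrent class of `σ` is
    -- imitated, and the label reached records the recurrence.
    obtain ⟨z, hz, hrec⟩ := exists_reach_recurrent (σ.chain G) (y.1, m)
    have hsim : ∃ w : σ.CollapsedMemory G r, w.1.2 = σ.label G r z.2 ∧ Consistent (z.1, w) ∧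
        Reach ((σ.collapse G r).chain G) y (z.1, w) := by
      clear hrec
      induction hz with
      | refl => exact ⟨y.2, hm, hcons, .refl⟩
      | tail _ he ih =>
        obtain ⟨w, hw, hc, hr⟩ := ih
        obtain ⟨w', -, hw', he'⟩ := collapse_simulates hc.1 hw he
        exact ⟨w', hw', hc.of_mem_support he', hr.tail he'⟩
    obtain ⟨w, hw, hc, hr⟩ := hsim
    refine ⟨(z.1, w), ⟨hc, ?_⟩, hr⟩
    rw [hw]
    exact recur_iff.2 hrec

/-- The strategy with its memory renamed along `e`. -/
noncomputable def reindex {M N A O : Type*} (σ : Strategy M A O) (e : M ≃ N) :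
    Strategy N A O where
  act n := σ.act (e.symm n)
  update n o a := (σ.update (e.symm n) o a).map e
  init := e σ.init

omit [Finite S] [Finite A] [Finite M] in
theorem reach_reindex {N : Type*} (e : M ≃ N) {x y : S × N} :
    Reach ((σ.reindex e).chain G) x y ↔
      Reach (σ.chain G) (x.1, e.symm x.2) (y.1, e.symm y.2) := by
  have hstep : ∀ x y : S × N, y ∈ ((σ.reindex e).chain G x).support ↔
      (y.1, e.symm y.2) ∈ (σ.chain G (x.1, e.symm x.2)).support := fun x y => by
    rw [mem_support_chain, mem_support_chain]
    simp only [reindex, PMF.mem_support_map_iff]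
    refine exists_congr fun a => and_congr_right fun _ => and_congr_right fun _ => ?_
    exact ⟨fun ⟨n, hn, h⟩ => by rwa [← h, e.symm_apply_apply], fun h => ⟨_, h, by simp⟩⟩
  constructor
  · exact fun h => h.lift (fun x => (x.1, e.symm x.2)) fun x y => (hstep x y).1
  · intro h
    have h' := Relation.ReflTransGen.lift
      (p := fun x y => y ∈ ((σ.reindex e).chain G x).support) (fun x : S × M => (x.1, e x.2))
      (fun x y hxy => (hstep _ _).2 (by simpa only [Equiv.symm_apply_apply] using hxy)) _ _ h
    simpa only [Function.onFun, Equiv.apply_symm_apply] using h'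

/-- Renaming preserves the graph, hence winning. This moves the collapsed memory from the universe
of `S` and `A` to a `Fin` in `Type`. -/
theorem AlmostSureWinning.reindex {N : Type*} [Finite N] (h : σ.AlmostSureWinning G r)
    (e : M ≃ N) : (σ.reindex e).AlmostSureWinning G r := by
  refine playMeasure_limAvgOne_eq_one_iff.2 fun y hy hrec a ha => ?_
  refine playMeasure_limAvgOne_eq_one_iff.1 h (y.1, e.symm y.2) ?_ (fun z hz => ?_) a ha
  · simpa [Strategy.reindex] using (reach_reindex e).1 hy
  · simpa using (reach_reindex e).1 (hrec (z.1, e z.2) ((reach_reindex e).2 (by simpa using hz)))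

/-- From every reachable configuration of a winning strategy, a recurrent configuration in which
only reward `1` occurs from then on is reachable. -/
theorem AlmostSureWinning.exists_recurrent (h : σ.AlmostSureWinning G r) {x : S × M}
    (hx : Reach (σ.chain G) (G.init, σ.init) x) :
    ∃ y, Reach (σ.chain G) x y ∧ ∀ z, Reach (σ.chain G) y z →
      ∀ a ∈ (σ.act z.2).support, r z.1 a = 1 := by
  obtain ⟨y, hy, hrec⟩ := exists_reach_recurrent (σ.chain G) x
  exact ⟨y, hy, fun z hz => playMeasure_limAvgOne_eq_one_iff.1 h z ((hx.trans hy).trans hz)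
    (hrec.of_reach hz)⟩

end Strategy

/-! ### Exponential memory is necessary -/

namespace DelayGame

open FiniteChain

/-- `none` is the initial state, `some none` the losing sink. In `some (some (k, b, c))` the bit `b`
has to be played in `k` steps, and `c` is the bit that is shown. -/
abbrev State (n : ℕ) : Type := Option (Option (Fin (n + 1) × Bool × Bool))

/-- The possible moves: the environment shows an arbitrary bit, and either it starts a new test for
that bit, or it carries on with the current test. -/
inductive Step (n : ℕ) : State n → Bool → State n → Prop
  | record (s : State n) (a c : Bool) (hs : s ≠ some none) :
      Step n s a (some (some (Fin.last n, c, c)))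
  | wait (k : Fin n) (b c a c' : Bool) :
      Step n (some (some (k.succ, b, c))) a (some (some (k.castSucc, b, c')))
  | fail (b c a : Bool) (h : a ≠ b) : Step n (some (some (0, b, c))) a (some none)
  | lost (a : Bool) : Step n (some none) a (some none)

/-- The POMDP in which the bits shown have to be repeated with a delay of `n` steps. -/
noncomputable def pomdp (n : ℕ) : POMDP (State n) Bool (Option Bool) where
  trans s a := Strategy.uniformOr {t | Step n s a t} s
  obs s := s.map fun t => t.elim true fun x => x.2.2
  init := none
  init_unique s h := by simpa using h

/-- Reward `0` in the losing sink, reward `1` elsewhere. -/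
def reward (n : ℕ) : State n → Bool → unitInterval
  | some none, _ => 0
  | _, _ => 1

theorem mem_support_trans {n : ℕ} {s t : State n} {a : Bool} :
    t ∈ ((pomdp n).trans s a).support ↔ Step n s a t := by
  have h : {t | Step n s a t}.Nonempty := by
    by_cases hs : s = some none
    · subst hs; exact ⟨_, Step.lost a⟩
    · exact ⟨_, .record s a true hs⟩
  exact Set.ext_iff.1 (Strategy.support_uniformOr h s) t

/-- The strategy that remembers the last `n + 1` bits and plays the oldest one. -/
noncomputable def queue (n : ℕ) : Strategy (Fin (n + 1) → Bool) Bool (Option Bool) where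
  act q := PMF.pure (q 0)
  update q o _ := PMF.pure (Fin.snoc (α := fun _ => Bool) (fun k : Fin n => q k.succ) (o.getD true))
  init _ := true

/-- Invariant: during a test with counter `k`, entry `k` of the queue is the required bit. Each
shift of the queue matches one decrement of the counter, so the bit is at the front when due. -/
theorem queue_almostSureWinning (n : ℕ) : (queue n).AlmostSureWinning (pomdp n) (reward n) := by
  set D : Set (State n × (Fin (n + 1) → Bool)) :=
    {x | x.1 ≠ some none ∧ ∀ k b c, x.1 = some (some (k, b, c)) → x.2 k = b} with hDdef
  have hclosed : ∀ x ∈ D, ∀ y ∈ ((queue n).chain (pomdp n) x).support, y ∈ D := by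
    rintro ⟨s, q⟩ ⟨hs, hq⟩ ⟨t, q'⟩ hy
    obtain ⟨a, ha, ht, hq'⟩ := Strategy.mem_support_chain.1 hy
    have hstep := mem_support_trans.1 ht
    obtain rfl : a = q 0 := by simpa [queue] using ha
    replace hq' : q' = Fin.snoc (α := fun _ => Bool) (fun k : Fin n => q k.succ)
      (((pomdp n).obs t).getD true) := by simpa [queue] using hq'
    subst hq'
    dsimp only at hstep hs hq
    cases hstep with
    | record _ _ c =>
      refine ⟨by simp, fun k b c' h => ?_⟩
      cases h
      simp [pomdp]
    | wait k b c _ c' =>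
      refine ⟨by simp, fun j b c' h => ?_⟩
      cases h
      simpa using hq _ _ _ rfl
    | fail b c _ h => exact absurd (hq _ _ _ rfl) h
    | lost => exact absurd rfl hs
  have hinit : ((pomdp n).init, (queue n).init) ∈ D := by simp [hDdef, pomdp]
  refine Strategy.playMeasure_limAvgOne_eq_one_of_closed hclosed ?_ fun y hy => ⟨y, ?_, .refl⟩
  · rintro ⟨s, q⟩ ⟨hs, -⟩ a -
    rcases s with _ | _ | s
    · rfl
    · exact absurd rfl hs
    · rfl
  · induction hy with
    | refl => exact hinit
    | tail _ he ih => exact hclosed _ ih _ he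

variable {n : ℕ} {M : Type*} {σ : Strategy M Bool (Option Bool)}

/-- `ShownMemory σ w m` says that `m` is a possible memory after the bits of `w` have been shown,
the latest bit being the head of `w`. -/
inductive ShownMemory (σ : Strategy M Bool (Option Bool)) : List Bool → M → Prop
  | nil : ShownMemory σ [] σ.init
  | cons {w : List Bool} {m m' : M} {a c : Bool} (h : ShownMemory σ w m)
      (ha : a ∈ (σ.act m).support) (hm : m' ∈ (σ.update m (some c) a).support) :
      ShownMemory σ (c :: w) m'

theorem exists_shownMemory (σ : Strategy M Bool (Option Bool)) (w : List Bool) :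
    ∃ m, ShownMemory σ w m := by
  induction w with
  | nil => exact ⟨_, .nil⟩
  | cons c w ih =>
    obtain ⟨m, hm⟩ := ih
    obtain ⟨a, ha⟩ := (σ.act m).support_nonempty
    obtain ⟨m', hm'⟩ := (σ.update m (some c) a).support_nonempty
    exact ⟨m', hm.cons ha hm'⟩

/-- From a common memory, equal observations and actions allow equal updates, whatever was shown
before. -/
theorem ShownMemory.exists_append {w w' : List Bool} {m : M} (h : ShownMemory σ w m)
    (h' : ShownMemory σ w' m) (t : List Bool) :
    ∃ m', ShownMemory σ (t ++ w) m' ∧ ShownMemory σ (t ++ w') m' := by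
  induction t with
  | nil => exact ⟨m, h, h'⟩
  | cons c t ih =>
    obtain ⟨m, hm, hm'⟩ := ih
    obtain ⟨a, ha⟩ := (σ.act m).support_nonempty
    obtain ⟨m', hu⟩ := (σ.update m (some c) a).support_nonempty
    exact ⟨m', hm.cons ha hu, hm'.cons ha hu⟩

/-- The environment may start a new test at every step, so any word can be shown. -/
theorem ShownMemory.reach {w : List Bool} {m : M} (h : ShownMemory σ w m) :
    Reach (σ.chain (pomdp n)) ((pomdp n).init, σ.init)
      (w.head?.map fun c => some (Fin.last n, c, c), m) := by
  induction h with
  | nil => exact .refl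
  | @cons w m m' a c _ ha hm ih =>
    refine ih.tail (Strategy.mem_support_chain.2 ⟨a, ha, mem_support_trans.2 ?_, hm⟩)
    refine .record _ _ _ ?_
    cases w <;> simp

/-- The environment may let the test of `b` be the last one started; each bit of `u` then lowers the
counter by one. -/
theorem ShownMemory.reach_test {u v : List Bool} {b : Bool} {m : M}
    (h : ShownMemory σ (u ++ b :: v) m) (j : Fin (n + 1)) (hj : j + u.length = n) :
    ∃ c, Reach (σ.chain (pomdp n)) ((pomdp n).init, σ.init) (some (some (j, b, c)), m) := by
  induction u generalizing j m with
  | nil =>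
    obtain rfl : j = Fin.last n := Fin.ext (by simpa using hj)
    exact ⟨b, h.reach⟩
  | cons c u ih =>
    rw [List.length_cons] at hj
    obtain ⟨k, rfl⟩ : ∃ k : Fin n, j = k.castSucc := ⟨⟨j, by omega⟩, rfl⟩
    cases h with
    | cons h ha hm =>
      obtain ⟨d, hd⟩ := ih h k.succ (by simp at hj ⊢; omega)
      exact ⟨c, hd.tail (Strategy.mem_support_chain.2
        ⟨_, ha, mem_support_trans.2 (.wait k b d _ c), hm⟩)⟩

variable [Finite M]

theorem not_reach_lost (h : σ.AlmostSureWinning (pomdp n) (reward n)) (m : M) :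
    ¬ Reach (σ.chain (pomdp n)) ((pomdp n).init, σ.init) (some none, m) := by
  intro hreach
  obtain ⟨y, hy, hr⟩ := h.exists_recurrent hreach
  have hlost : y.1 = some none := by
    clear hr
    induction hy with
    | refl => rfl
    | @tail y z _ he ih =>
      obtain ⟨a, -, hs, -⟩ := Strategy.mem_support_chain.1 he
      have hs := mem_support_trans.1 hs
      rw [ih] at hs
      generalize z.1 = t at hs
      cases hs with
      | record _ _ _ h => exact absurd rfl h
      | lost => rfl
  obtain ⟨a, ha⟩ := (σ.act y.2).support_nonempty
  have := hr y .refl a ha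
  rw [hlost] at this
  exact zero_ne_one this

theorem two_pow_le_card (h : σ.AlmostSureWinning (pomdp n) (reward n)) :
    2 ^ n ≤ Nat.card M := by
  choose f hf using fun w : Fin n → Bool => exists_shownMemory σ (List.ofFn w)
  have hinj : Function.Injective f := by
    intro w w' hww
    by_contra hne
    obtain ⟨i, hi⟩ := Function.ne_iff.1 hne
    have hsplit : ∀ w : Fin n → Bool, List.ofFn w =
        (List.ofFn w).take i ++ w i :: (List.ofFn w).drop (i + 1) := fun w => by
      have hlt : (i : ℕ) < (List.ofFn w).length := by simp
      rw [show w i = (List.ofFn w)[(i : ℕ)] by simp, List.getElem_cons_drop,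
        List.take_append_drop]
    -- Exactly `i` bits follow the one at position `i`, the latest being the head, so its counter
    -- stands at `n - i`; that many further bits bring it to `0`.
    obtain ⟨m, hm, hm'⟩ := (hf w).exists_append (hww ▸ hf w') (List.replicate (n - i) true)
    have hlen : ∀ w : Fin n → Bool, ((0 : Fin (n + 1)) : ℕ) +
        (List.replicate (n - i) true ++ (List.ofFn w).take i).length = n := fun w => by
      simp
    rw [hsplit w, ← List.append_assoc] at hm
    rw [hsplit w', ← List.append_assoc] at hm'
    obtain ⟨c, hc⟩ := hm.reach_test 0 (hlen w)
    obtain ⟨c', hc'⟩ := hm'.reach_test 0 (hlen w')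
    obtain ⟨a, ha⟩ := (σ.act m).support_nonempty
    obtain ⟨m', hm'⟩ := (σ.update m ((pomdp n).obs (some none)) a).support_nonempty
    by_cases haw : a = w i
    · exact not_reach_lost h m' (hc'.tail (Strategy.mem_support_chain.2
        ⟨a, ha, mem_support_trans.2 (.fail _ _ _ (haw ▸ hi)), hm'⟩))
    · exact not_reach_lost h m' (hc.tail (Strategy.mem_support_chain.2
        ⟨a, ha, mem_support_trans.2 (.fail _ _ _ haw), hm'⟩))
  have := Nat.card_le_card_of_injective f hinj
  simpa using this

end DelayGame

/-! ### Beliefs are not sufficient -/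

namespace BeliefExample

open FiniteChain St Ac

instance : Fintype St := ⟨{s0, X, X', Y, Y', Z, Z'}, fun s => by cases s <;> simp⟩

instance : Finite Ac :=
  Finite.of_surjective (fun i : Bool => if i then a else b) fun c => by
    cases c
    exacts [⟨true, rfl⟩, ⟨false, rfl⟩]

/-- The possible successors of a state. -/
def successors : St → Ac → Finset St
  | s0, _ => {X, X', Y, Y', Z, Z'}
  | X, a => {X'}
  | X, b => {Y}
  | X', a => {Y'}
  | X', b => {X}
  | Z, a => {Y}
  | Z, b => {Z'}
  | Z', a => {Z}
  | Z', b => {Y'}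
  | Y, _ => {X, Z}
  | Y', _ => {X', Z'}

theorem mem_support_trans {s t : St} {c : Ac} :
    t ∈ (trans s c).support ↔ t ∈ successors s c := by
  cases s
  case s0 => exact PMF.mem_support_uniformOfFinset_iff ⟨X, by decide⟩ _
  case Y => exact PMF.mem_support_uniformOfFinset_iff ⟨X, by decide⟩ _
  case Y' => exact PMF.mem_support_uniformOfFinset_iff ⟨X', by decide⟩ _
  all_goals cases c <;> exact (PMF.mem_support_pure_iff _ _).trans Finset.mem_singleton.symm

/-- The strategy that plays `a` and `b` alternately. -/
noncomputable def alternate : Strategy Bool Ac Bool where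
  act i := PMF.pure (if i then a else b)
  update i _ _ := PMF.pure !i
  init := true

theorem mem_support_alternate {x y : St × Bool} :
    y ∈ (alternate.chain pomdp x).support ↔
      y.1 ∈ (trans x.1 (if x.2 then a else b)).support ∧ y.2 = !x.2 := by
  rw [Strategy.mem_support_chain]
  simp only [alternate, PMF.support_pure, Set.mem_singleton_iff, exists_eq_left]
  rfl

/-- With `true` announcing `a`, the set `D` consists of two cycles of reward `1`, between `X` and
`X'` and between `Z` and `Z'`. From `Y` and `Y'`, whatever the phase, one of the two successors is
in step with its cycle. -/
theorem alternate_almostSureWinning : alternate.AlmostSureWinning pomdp reward := by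
  set D : Set (St × Bool) := {(X, true), (X', false), (Z, false), (Z', true)}
  refine Strategy.playMeasure_limAvgOne_eq_one_of_closed
    (D := D) ?_ ?_ fun y _ => ?_
  · rintro x (rfl | rfl | rfl | rfl) ⟨s, i⟩ hy <;>
      · obtain ⟨h1, h2⟩ := mem_support_alternate.1 hy
        simp [mem_support_trans, successors, -PMF.mem_support_iff] at h1 h2
        simp [h1, h2, D]
  · rintro x (rfl | rfl | rfl | rfl) c - <;> rfl
  · have hstep : ∀ {s : St} {i : Bool} (t : St), t ∈ (trans s (if i then a else b)).support →
        (∃ z ∈ D, Reach (alternate.chain pomdp) (t, !i) z) →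
        ∃ z ∈ D, Reach (alternate.chain pomdp) (s, i) z :=
      fun t ht ⟨z, hz, h⟩ => ⟨z, hz, h.head (mem_support_alternate.2 ⟨ht, rfl⟩)⟩
    have hX : ∃ z ∈ D, Reach (alternate.chain pomdp) (X, true) z := ⟨_, .inl rfl, .refl⟩
    have hX' : ∃ z ∈ D, Reach (alternate.chain pomdp) (X', false) z := ⟨_, .inr (.inl rfl), .refl⟩
    have hZ : ∃ z ∈ D, Reach (alternate.chain pomdp) (Z, false) z :=
      ⟨_, .inr (.inr (.inl rfl)), .refl⟩
    have hZ' : ∃ z ∈ D, Reach (alternate.chain pomdp) (Z', true) z :=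
      ⟨_, .inr (.inr (.inr rfl)), .refl⟩
    have hY : ∀ i, ∃ z ∈ D, Reach (alternate.chain pomdp) (Y, i) z
      | true => hstep Z (by simp [mem_support_trans, successors, -PMF.mem_support_iff]) hZ
      | false => hstep X (by simp [mem_support_trans, successors, -PMF.mem_support_iff]) hX
    have hY' : ∀ i, ∃ z ∈ D, Reach (alternate.chain pomdp) (Y', i) z
      | true => hstep X' (by simp [mem_support_trans, successors, -PMF.mem_support_iff]) hX'
      | false => hstep Z' (by simp [mem_support_trans, successors, -PMF.mem_support_iff]) hZ'
    match y with
    | (s0, true) => exact hstep X' (by simp [mem_support_trans, successors, -PMF.mem_support_iff]) hX'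
    | (s0, false) => exact hstep X (by simp [mem_support_trans, successors, -PMF.mem_support_iff]) hX
    | (X, true) => exact hX
    | (X, false) => exact hstep Y (by simp [mem_support_trans, successors, -PMF.mem_support_iff]) (hY _)
    | (X', true) => exact hstep Y' (by simp [mem_support_trans, successors, -PMF.mem_support_iff]) (hY' _)
    | (X', false) => exact hX'
    | (Y, i) => exact hY i
    | (Y', i) => exact hY' i
    | (Z, true) => exact hstep Y (by simp [mem_support_trans, successors, -PMF.mem_support_iff]) (hY _)
    | (Z, false) => exact hZ
    | (Z', true) => exact hZ'
    | (Z', false) => exact hstep Y' (by simp [mem_support_trans, successors, -PMF.mem_support_iff]) (hY' _)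

/-- The belief after the initial state has been left. -/
theorem beliefUpdate_init (c : Ac) : pomdp.beliefUpdate {s0} c false = {s | s ≠ s0} := by
  ext s
  cases c <;> cases s <;> simp [POMDP.beliefUpdate, pomdp, mem_support_trans, successors,
    -PMF.mem_support_iff]

/-- Under either action each of the six states has a predecessor among the six, so the belief never
shrinks. -/
theorem beliefUpdate_ne_init (c : Ac) :
    pomdp.beliefUpdate {s | s ≠ s0} c false = {s | s ≠ s0} := by
  ext s
  constructor
  · rintro ⟨-, hs⟩
    simpa [pomdp] using hs
  · intro hs
    refine ⟨?_, by simpa [pomdp] using hs⟩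
    have key : ∀ t, t ≠ s0 → s ∈ (trans t c).support →
        s ∈ ⋃ t ∈ {t | t ≠ s0}, (pomdp.trans t c).support := fun t ht h =>
      Set.mem_biUnion (show t ∈ {t | t ≠ s0} from ht) h
    cases c <;> cases s
    · exact absurd rfl hs
    · exact key Y (by decide) (by simp [mem_support_trans, successors, -PMF.mem_support_iff])
    · exact key X (by decide) (by simp [mem_support_trans, successors, -PMF.mem_support_iff])
    · exact key Z (by decide) (by simp [mem_support_trans, successors, -PMF.mem_support_iff])
    · exact key X' (by decide) (by simp [mem_support_trans, successors, -PMF.mem_support_iff])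
    · exact key Z' (by decide) (by simp [mem_support_trans, successors, -PMF.mem_support_iff])
    · exact key Y' (by decide) (by simp [mem_support_trans, successors, -PMF.mem_support_iff])
    · exact absurd rfl hs
    · exact key X' (by decide) (by simp [mem_support_trans, successors, -PMF.mem_support_iff])
    · exact key Y' (by decide) (by simp [mem_support_trans, successors, -PMF.mem_support_iff])
    · exact key X (by decide) (by simp [mem_support_trans, successors, -PMF.mem_support_iff])
    · exact key Z' (by decide) (by simp [mem_support_trans, successors, -PMF.mem_support_iff])
    · exact key Y (by decide) (by simp [mem_support_trans, successors, -PMF.mem_support_iff])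
    · exact key Z (by decide) (by simp [mem_support_trans, successors, -PMF.mem_support_iff])

theorem mem_support_beliefBased {f : Set St → PMF Ac} {x y : St × Set St} :
    y ∈ ((Strategy.beliefBased pomdp f).chain pomdp x).support ↔ ∃ c ∈ (f x.2).support,
      y.1 ∈ (trans x.1 c).support ∧ y.2 = pomdp.beliefUpdate x.2 c (pomdp.obs y.1) := by
  rw [Strategy.mem_support_chain]
  simp only [Strategy.beliefBased, PMF.support_pure, Set.mem_singleton_iff]
  rfl

theorem ne_init_of_mem_support {s t : St} {c : Ac} (h : t ∈ (trans s c).support) : t ≠ s0 := by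
  rintro rfl
  cases c <;> cases s <;> simp [mem_support_trans, successors, -PMF.mem_support_iff] at h

theorem not_beliefBased_almostSureWinning (f : Set St → PMF Ac) :
    ¬ (Strategy.beliefBased pomdp f).AlmostSureWinning pomdp reward := by
  intro h
  set B : Set St := {s | s ≠ s0}
  have hobs : ∀ s, s ≠ s0 → pomdp.obs s = false := fun s hs => by simp [pomdp, hs]
  obtain ⟨y, hy, hr⟩ := h.exists_recurrent .refl
  have hzero : ∀ z, Reach ((Strategy.beliefBased pomdp f).chain pomdp) y z →
      z.1 ≠ Y ∧ z.1 ≠ Y' := fun z hz => by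
    obtain ⟨c, hc⟩ := (f z.2).support_nonempty
    have h1 := hr z hz c hc
    constructor <;>
      · intro h2
        rw [h2] at h1
        exact zero_ne_one h1
  have hstep : ∀ s t c, c ∈ (f B).support → t ∈ (trans s c).support →
      (t, B) ∈ ((Strategy.beliefBased pomdp f).chain pomdp (s, B)).support := fun s t c hc ht => by
    refine mem_support_beliefBased.2 ⟨c, hc, ht, ?_⟩
    rw [hobs _ (ne_init_of_mem_support ht)]
    exact (beliefUpdate_ne_init c).symm
  -- The belief is `B` from the first step on, so from here the strategy always plays `f B`.
  have hB : ∃ s, s ≠ s0 ∧ Reach ((Strategy.beliefBased pomdp f).chain pomdp) y (s, B) := by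
    have hinv : y = (s0, {s0}) ∨ (y.1 ≠ s0 ∧ y.2 = B) := by
      clear hr hzero
      induction hy with
      | refl => exact .inl rfl
      | @tail y z _ he ih =>
        obtain ⟨c, hc, ht, hz⟩ := mem_support_beliefBased.1 he
        refine .inr ⟨ne_init_of_mem_support ht, hz.trans ?_⟩
        rw [hobs _ (ne_init_of_mem_support ht)]
        rcases ih with rfl | ⟨-, ih⟩
        · exact beliefUpdate_init c
        · rw [ih]; exact beliefUpdate_ne_init c
    rcases hinv with rfl | ⟨h1, h2⟩
    · obtain ⟨c, hc⟩ := (f {s0}).support_nonempty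
      refine ⟨X, by decide, .single (mem_support_beliefBased.2 ⟨c, hc, ?_, ?_⟩)⟩
      · simp [mem_support_trans, successors, -PMF.mem_support_iff]
      · exact (beliefUpdate_init c).symm
    · exact ⟨y.1, h1, by rw [← h2]⟩
  obtain ⟨s, hs, hsr⟩ := hB
  obtain ⟨c, hc⟩ := (f B).support_nonempty
  have hY : ¬ Reach ((Strategy.beliefBased pomdp f).chain pomdp) y (Y, B) := fun h =>
    (hzero _ h).1 rfl
  have hY' : ¬ Reach ((Strategy.beliefBased pomdp f).chain pomdp) y (Y', B) := fun h =>
    (hzero _ h).2 rfl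
  have hback : ∀ {s : St} (t : St), t ∈ (trans s c).support →
      ¬ Reach ((Strategy.beliefBased pomdp f).chain pomdp) y (t, B) →
      ¬ Reach ((Strategy.beliefBased pomdp f).chain pomdp) y (s, B) := fun t ht hn h =>
    hn (h.tail (hstep _ t c hc ht))
  refine absurd hsr ?_
  -- Repeating `a` follows `X → X' → Y'` and `Z' → Z → Y`; repeating `b` follows `X' → X → Y` and `Z
  -- → Z' → Y'`. Unreachability of `Y` and `Y'` is propagated backwards along these paths.
  cases c with
  | a =>
    have hX' := hback (s := X') Y' (by simp [mem_support_trans, successors, -PMF.mem_support_iff]) hY'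
    have hZ := hback (s := Z) Y (by simp [mem_support_trans, successors, -PMF.mem_support_iff]) hY
    cases s with
    | s0 => exact absurd rfl hs
    | X => exact hback X' (by simp [mem_support_trans, successors, -PMF.mem_support_iff]) hX'
    | X' => exact hX'
    | Y => exact hY
    | Y' => exact hY'
    | Z => exact hZ
    | Z' => exact hback Z (by simp [mem_support_trans, successors, -PMF.mem_support_iff]) hZ
  | b =>
    have hX := hback (s := X) Y (by simp [mem_support_trans, successors, -PMF.mem_support_iff]) hY
    have hZ' := hback (s := Z') Y' (by simp [mem_support_trans, successors, -PMF.mem_support_iff]) hY'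
    cases s with
    | s0 => exact absurd rfl hs
    | X => exact hX
    | X' => exact hback X (by simp [mem_support_trans, successors, -PMF.mem_support_iff]) hX
    | Y => exact hY
    | Y' => exact hY'
    | Z => exact hback Z' (by simp [mem_support_trans, successors, -PMF.mem_support_iff]) hZ'
    | Z' => exact hZ'

end BeliefExample

theorem mainTheorem2 :
    -- upper bound on the memory
    (∀ (S A O : Type*) [Finite S] [Finite A] [Finite O] (G : POMDP S A O)
        (r : S → A → unitInterval),
      (∃ (M : Type) (_ : Finite M) (σ : Strategy M A O), σ.AlmostSureWinning G r) →
      ∃ (M : Type) (_ : Finite M) (σ : Strategy M A O),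
        Nat.card M ≤ 2 ^ (3 * Nat.card S + Nat.card A) ∧ σ.AlmostSureWinning G r) ∧
    -- the collapsed strategy of any winning finite-memory strategy is such a strategy
    (∀ (S A O M : Type*) [Finite S] [Finite A] [Finite O] [Finite M] (G : POMDP S A O)
        (r : S → A → unitInterval) (σ : Strategy M A O), σ.AlmostSureWinning G r →
      Nat.card (σ.CollapsedMemory G r) ≤ 2 ^ (3 * Nat.card S + Nat.card A) ∧
        (σ.collapse G r).AlmostSureWinning G r) ∧
    -- exponential memory is necessary
    (∃ C : ℕ, ∀ n : ℕ, 1 ≤ n →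
      ∃ (S A O : Type) (_ : Finite S) (_ : Finite A) (_ : Finite O) (G : POMDP S A O)
        (r : S → A → unitInterval),
        Nat.card S + Nat.card A + Nat.card O ≤ C * n ∧
        (∃ (M : Type) (_ : Finite M) (σ : Strategy M A O), σ.AlmostSureWinning G r) ∧
        ∀ (M : Type) (_ : Finite M) (σ : Strategy M A O), σ.AlmostSureWinning G r →
          2 ^ n ≤ Nat.card M) ∧
    -- belief-based strategies are not sufficient, as the explicit example shows
    ((∃ (M : Type) (_ : Finite M) (σ : Strategy M BeliefExample.Ac Bool),
        σ.AlmostSureWinning BeliefExample.pomdp BeliefExample.reward) ∧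
      ∀ f : Set BeliefExample.St → PMF BeliefExample.Ac,
        ¬ (Strategy.beliefBased BeliefExample.pomdp f).AlmostSureWinning
          BeliefExample.pomdp BeliefExample.reward) := by
  -- The delay game has `4 * (n + 1) + 2` states, `2` actions and `3` observations, in total `4 * n
  -- + 11 ≤ 16 * n` for `n ≥ 1`.
  refine ⟨?_, ?_, ⟨16, fun n hn => ?_⟩,
    ⟨Bool, inferInstance, _, BeliefExample.alternate_almostSureWinning⟩,
    BeliefExample.not_beliefBased_almostSureWinning⟩
  · rintro S A O _ _ _ G r ⟨M, _, σ, hσ⟩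
    refine ⟨Fin (Nat.card (σ.CollapsedMemory G r)), inferInstance, _, ?_,
      hσ.collapse.reindex (Finite.equivFin _)⟩
    rw [Nat.card_fin]
    exact Strategy.card_collapsedMemory_le
  · intro S A O M _ _ _ _ G r σ hσ
    exact ⟨Strategy.card_collapsedMemory_le, hσ.collapse⟩
  · refine ⟨DelayGame.State n, Bool, Option Bool, inferInstance, inferInstance, inferInstance,
      DelayGame.pomdp n, DelayGame.reward n, ?_,
      ⟨_, inferInstance, _, DelayGame.queue_almostSureWinning n⟩,
      fun M _ σ hσ => DelayGame.two_pow_le_card hσ⟩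
    simp only [Nat.card_eq_fintype_card, Fintype.card_option, Fintype.card_prod, Fintype.card_fin,
      Fintype.card_bool]
    omega
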